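/- **Setting.** Let $K_n$ be the complete camera graph on $[n]$, let $E_b\subset E(K_n)$ be the set of corrupted camera edges, and let $\Delta_E=\max_i\deg_{E_b}(i)$. A triangle is a $3$-subset of $[n]$; it is *clean* if none of its three edges is in $E_b$. Let $\mathcal T_0$ be the set of all clean triangles and $\mathcal T=\mathcal T_0\sqcup\mathcal T_b$ the set of retained triangles, where $\mathcal T_b$ is any set of non-clean triangles (those that are not degenerate). Every pair $\{t,u\}\subset\mathcal T$ of triangles that share an edge is used as a constraint, with measured offset $g_{tu}=-g_{ut}\in\mathbb R$. There are true clean log-scales $z^\star\in\mathbb R^{\mathcal T_0}$ with $g_{tu}=z^\star_u-z^\star_t$ whenever $t,u\in\mathcal T_0$ share an edge; if $t$ or $u$ is not clean, $g_{tu}$ is arbitrary. **Losses.** Let $a,m,K>0$. A family $\rho_\sigma:\mathbb R\to[0,\infty)$, $\sigma>0$, of even continuous functions, differentiable on $|r|\le a\sigma$ and off a finite set of kinks, with score $\psi_\sigma=\rho_\sigma'$, is *$a$-profile-admissible with constants $m=m(a)$ and $K$* if for every $\sigma>0$: $\psi_\sigma$ is odd with $\psi_\sigma(0)=0$; $\psi_\sigma(r)/r\ge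 m$ for $0<|r|\le a\sigma$; $|\psi_\sigma(r)|\le K\sigma$ for all $r$; and $\psi_\sigma$ is redescending in shape, i.e. for some $p_\sigma\ge0$ it is nondecreasing on $[0,p_\sigma]$ and nonincreasing on $[p_\sigma,\infty)$ (away from the kinks). Put $h_{\rm prof}(a)=\dfrac{a\,m(a)}{2K}$. **Objective and solver.** Let $F_\sigma(z_0,z_b)=\sum_{\{t,u\}}\rho_\sigma(z_u-z_t-g_{tu})$, summed over all constraints, and $\Phi_\sigma(z_0)=\inf_{z_b\in\mathbb R^{\mathcal T_b}}F_\sigma(z_0,z_b)$ for $z_0\in\mathbb R^{\mathcal T_0}$. Let $E(z_0)=\min_{\alpha\in\mathbb R}\|z_0-z^\star-\alpha\mathbf 1\|_\infty$. A *clean-basin stationary point* at scale $\sigma$ is a full vector $(z_0,z_b)$ with $0\in\partial\Phi_\sigma(z_0)$ (Clarke subdifferential) and $E(z_0)\le\frac a2\sigma$. For $\sigma_k=\sigma_0\tau^k$, an *annealed run* is a sequence of full vectors $(z_0^{(k)},z_b^{(k)})$, $k\ge0$, such that the vector with $k=0$ is a clean-basin stationary point at scale $\sigma_0$ and, for every $k$,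 if $E(z_0^{(k)})\le\frac a2\sigma_{k+1}$ then $(z_0^{(k+1)},z_b^{(k+1)})$ is a clean-basin stationary point at scale $\sigma_{k+1}$. **Theorem.** For all $a,m,K>0$ there is $n_0$ such that for all $n\ge n_0$ and all $E_b\subset E(K_n)$ with $$\frac{\Delta_E}{n}<\min\left\{\frac1{200},\ \frac{h_{\rm prof}(a)}{96+2h_{\rm prof}(a)}\right\}$$ there is a number $\gamma$ with $$0\le\gamma<h_{\rm prof}(a),\qquad \gamma\le16\cdot\frac{6\Delta_E}{n-3-2\Delta_E},$$ such that the following holds for every $a$-profile-admissible loss family with constants $m,K$, all data $(\mathcal T_b,g,z^\star)$ as above, all $\sigma_0>0$, all $\tau$ with $\frac{2\gamma K}{a\,m}<\tau<1$, and every annealed run with scales $\sigma_k=\sigma_0\tau^k$: for all $k\ge0$, $$E(z_0^{(k)})\le\frac{\gamma K}{m}\sigma_k\le\frac a2\sigma_{k+1},\qquad E(z_0^{(k)})\le\frac a2\sigma_0\tau^k .$$ Consequently the clean log-scales are recovered up to gauge: for every linear functional $\ell$ on $\mathbb R^{\mathcal T_0}$ with $\ell(\mathbf 1)=1$ and every $\beta\in\mathbb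 R$, the iterates normalized by $\ell=\beta$ satisfy $$z^{(k)}_t-\ell(z_0^{(k)})+\beta\ \longrightarrow\ z^\star_t+\alpha_\infty\quad(k\to\infty),\qquad \alpha_\infty=\beta-\ell(z^\star),\qquad t\in\mathcal T_0 .$$ -/

import Mathlib

open Filter Topology

noncomputable section

/-! ### Clarke subdifferential -/

/-- Clarke's generalized directional derivative
`limsup_{y → x, s ↓ 0} (f (y + s v) - f y) / s`, as an extended real number. -/
def clarkeDeriv {E : Type*} [AddCommGroup E] [Module ℝ E] [TopologicalSpace E]
    (f : E → ℝ) (x v : E) : EReal :=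
  limsup (fun p : E × ℝ => (((f (p.1 + p.2 • v) - f p.1) / p.2 : ℝ) : EReal))
    (𝓝 x ×ˢ 𝓝[>] (0 : ℝ))

/-- The Clarke subdifferential of `f` at `x`. -/
def clarkeSubdifferential {E : Type*} [AddCommGroup E] [Module ℝ E] [TopologicalSpace E]
    (f : E → ℝ) (x : E) : Set (E →L[ℝ] ℝ) :=
  {ξ | ∀ v : E, ((ξ v : ℝ) : EReal) ≤ clarkeDeriv f x v}

/-! ### Redescending losses -/

/-- The score `ψ_σ = ρ_σ'` of a loss family. -/
def score (ρ : ℝ → ℝ → ℝ) (σ r : ℝ) : ℝ := deriv (ρ σ) r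

/-- An `a`-profile-admissible redescending loss family `ρ_σ` with constants `m = m(a)` and `K`,
which do not depend on the scale `σ > 0`.  Finitely many kinks outside of the clean window
`|r| ≤ a σ` are allowed (hard thresholding); a loss without kinks is the case where
`finite_kinks` is about the empty set. -/
structure ProfileAdmissible (ρ : ℝ → ℝ → ℝ) (a m K : ℝ) : Prop where
  nonneg : ∀ σ > 0, ∀ r, 0 ≤ ρ σ r
  even : ∀ σ > 0, ∀ r, ρ σ (-r) = ρ σ r
  continuous : ∀ σ > 0, Continuous (ρ σ)
  finite_kinks : ∀ σ > 0, {r : ℝ | ¬ DifferentiableAt ℝ (ρ σ) r}.Finite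
  differentiable_window : ∀ σ > 0, ∀ r, |r| ≤ a * σ → DifferentiableAt ℝ (ρ σ) r
  /-- The score is odd and vanishes at the origin. -/
  odd : ∀ σ > 0, ∀ r, score ρ σ (-r) = - score ρ σ r
  zero : ∀ σ > 0, score ρ σ 0 = 0
  /-- Clean-window lower slope.  (The value `ψ_σ'(0)` of the ratio at `r = 0`, when it exists,
  is then also at least `m`.) -/
  window_slope : ∀ σ > 0, ∀ r, r ≠ 0 → |r| ≤ a * σ → m ≤ score ρ σ r / r
  /-- Global maximum score. -/
  score_bound : ∀ σ > 0, ∀ r, |score ρ σ r| ≤ K * σ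
  /-- Redescending shape: away from kinks, the score rises on `[0, p]` up to its peak `p` and
  does not rise again on `[p, ∞)`.  The peak may lie inside or outside of the clean window. -/
  redescending : ∀ σ > 0, ∃ p : ℝ, 0 ≤ p ∧
    MonotoneOn (score ρ σ) {r | DifferentiableAt ℝ (ρ σ) r ∧ 0 ≤ r ∧ r ≤ p} ∧
    AntitoneOn (score ρ σ) {r | DifferentiableAt ℝ (ρ σ) r ∧ p ≤ r}

/-- The small-gain threshold `h_prof(a) = a m(a) / (2 K)`. -/
def hProf (a m K : ℝ) : ℝ := a * m / (2 * K)

/-! ### Triangles of the complete camera graph -/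

/-- A triangle of `K_n`: a set of three cameras. -/
abbrev Tri (n : ℕ) := {t : Finset (Fin n) // t.card = 3}

/-- Two triangles are joined by a constraint iff they share exactly one camera edge. -/
def SharesEdge {n : ℕ} (t u : Tri n) : Prop := (t.1 ∩ u.1).card = 2

/-- A triangle is clean iff none of its camera edges is corrupted. -/
def IsClean {n : ℕ} (Eb : SimpleGraph (Fin n)) (t : Tri n) : Prop :=
  ∀ i ∈ t.1, ∀ j ∈ t.1, ¬ Eb.Adj i j

/-- The clean triangles. -/
abbrev CleanTri {n : ℕ} (Eb : SimpleGraph (Fin n)) := {t : Tri n // IsClean Eb t}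

/-- The data of log-scale synchronization on `K_n` with corrupted camera edges `Eb`.
Retained triangles: every clean one, and any collection of non-clean ones (those which are not
degenerate).  For retained triangles `t`, `u` that share an edge, `offset t u = g_{tu}` is the
measured value of `z_u - z_t`.  It is exact between two clean triangles, and arbitrary as soon as
one of them is not clean. -/
structure ScaleData {n : ℕ} (Eb : SimpleGraph (Fin n)) where
  retained : Finset (Tri n)
  clean_retained : ∀ t, IsClean Eb t → t ∈ retained
  offset : Tri n → Tri n → ℝ
  offset_swap : ∀ t u, offset u t = - offset t u
  /-- The true log-scales `z⋆` of the clean triangles. -/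
  trueScale : CleanTri Eb → ℝ
  offset_clean : ∀ t u : CleanTri Eb, SharesEdge t.1 u.1 →
    offset t.1 u.1 = trueScale u - trueScale t

namespace ScaleData

variable {n : ℕ} {Eb : SimpleGraph (Fin n)} (D : ScaleData Eb)

/-- The retained non-clean triangles. -/
abbrev BadTri := {t : Tri n // t ∈ D.retained ∧ ¬ IsClean Eb t}

open Classical in
/-- The full vector `z = (z_0, z_b)`. -/
def join (z0 : CleanTri Eb → ℝ) (zb : D.BadTri → ℝ) : D.retained → ℝ := fun t =>
  if h : IsClean Eb t.1 then z0 ⟨t.1, h⟩ else zb ⟨t.1, t.2, h⟩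

/-- The clean block `z_0` of a full vector `z`. -/
def cleanBlock (z : D.retained → ℝ) : CleanTri Eb → ℝ := fun t =>
  z ⟨t.1, D.clean_retained t.1 t.2⟩

open Classical in
/-- The full all-triangle robust objective `F_σ(z)`: the sum of `ρ_σ(z_u - z_t - g_{tu})` over all
shared-edge constraints `{t, u}` of retained triangles.  Both orders of each pair are summed and
the result is halved; the two summands agree, the loss being even. -/
def fullObjective (ρ : ℝ → ℝ → ℝ) (σ : ℝ) (z : D.retained → ℝ) : ℝ :=
  (1 / 2) * ∑ t : D.retained, ∑ u : D.retained,
    if SharesEdge t.1 u.1 then ρ σ (z u - z t - D.offset t.1 u.1) else 0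

/-- The profiled objective `Φ_σ(z_0) = inf_{z_b} F_σ(z_0, z_b)`. -/
def profiledObjective (ρ : ℝ → ℝ → ℝ) (σ : ℝ) (z0 : CleanTri Eb → ℝ) : ℝ :=
  ⨅ zb : D.BadTri → ℝ, D.fullObjective ρ σ (D.join z0 zb)

/-- The gauge-invariant error `E(z_0) = min_α ‖z_0 - z_0⋆ - α 1‖_∞`. -/
def gaugeError (z0 : CleanTri Eb → ℝ) : ℝ :=
  ⨅ α : ℝ, ⨆ t : CleanTri Eb, |z0 t - D.trueScale t - α|

/-- The clean block of `z` is a clean-basin stationary point of the profiled objective at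
scale `σ`: `0 ∈ ∂Φ_σ(z_0)` and `E(z_0) ≤ (a / 2) σ`. -/
def IsCleanBasinStationary (ρ : ℝ → ℝ → ℝ) (a σ : ℝ) (z : D.retained → ℝ) : Prop :=
  (0 : (CleanTri Eb → ℝ) →L[ℝ] ℝ) ∈
      clarkeSubdifferential (D.profiledObjective ρ σ) (D.cleanBlock z) ∧
    D.gaugeError (D.cleanBlock z) ≤ a / 2 * σ

/-- An output `z⁽⁰⁾, z⁽¹⁾, …` of the annealed solver with scales `σ_k = σ₀ τ^k`: it starts at a
clean-basin stationary point for `σ₀`, and whenever the current iterate lies in the clean basin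
`E ≤ (a / 2) σ_{k+1}` of the next scale, the next iterate is a clean-basin stationary point for
that scale.  (Nothing is assumed about the next iterate otherwise.) -/
def IsAnnealedRun (ρ : ℝ → ℝ → ℝ) (a σ₀ τ : ℝ) (z : ℕ → D.retained → ℝ) : Prop :=
  D.IsCleanBasinStationary ρ a σ₀ (z 0) ∧
    ∀ k : ℕ, D.gaugeError (D.cleanBlock (z k)) ≤ a / 2 * (σ₀ * τ ^ (k + 1)) →
      D.IsCleanBasinStationary ρ a (σ₀ * τ ^ (k + 1)) (z (k + 1))

end ScaleData

end

/-! Let X be the error `z_0 - z⋆` on the clean triangles. Moving one clean coordinate by a small `s`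
changes each constraint to a clean neighbour at rate `ψ (X t - X u)`, and each constraint to a bad
neighbour by at most `K σ |s|`, whatever `z_b` is. The second bound is uniform in `z_b`, so it
survives the infimum, and no minimizing `z_b` is needed. A clean triangle has at most `6 Δ` bad
neighbours, so at a Clarke stationary point its net flow to clean neighbours is at most `6 Δ K σ` in
absolute value (`abs_netFlow_le`).

Small net flows force small oscillation (`mul_sub_le_of_abs_netFlow_le`), by a maximum principle on
faces F (sets of at most three vertices). At a clean triple maximizing X over those containing F,
exchanging a vertex outside F only sends flow out, at least the flow level of the drop from the
maximum over F to that over `insert r F`. Exchanging `j ∈ F` brings in at most the flow level of the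
rise from F to `F.erase j`. Hence the average drop in passing from F to `insert r F` is controlled
by the drops already made (`exists_sum_faceMax_sub_le`). Adding the same estimate for `-X` and going
along ∅, {p}, {s, p}, a full triple, where the oscillation is zero, bounds the total oscillation.

The score need not be monotone on the window, so levels are measured by its truncation at `m a σ`,
which is monotone there; the small-gain hypothesis keeps every inflow level below the cut. The
resulting bound `E ≤ γ (K / m) σ` with `γ = 96 Δ / n` puts each iterate in the clean basin of the
next scale, and the annealing claim follows by induction. -/

noncomputable section

/-! ### Regularity of the losses -/

/-- A differentiable function whose derivative is monotone on a right neighbourhood has a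
right-continuous derivative. -/
lemma tendsto_deriv_nhdsGT_of_monotoneOn {f : ℝ → ℝ} {x b : ℝ} (hxb : x < b)
    (hf : ∀ y ∈ Set.Ico x b, DifferentiableAt ℝ f y) (hmono : MonotoneOn (deriv f) (Set.Ico x b)) :
    Tendsto (deriv f) (𝓝[>] x) (𝓝 (deriv f x)) := by
  have hbdd : BddBelow (deriv f '' Set.Ioo x b) := by
    refine ⟨deriv f x, ?_⟩
    rintro _ ⟨y, hy, rfl⟩
    exact hmono ⟨le_rfl, hxb⟩ ⟨hy.1.le, hy.2⟩ hy.1.le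
  have hlim := (hmono.mono Set.Ioo_subset_Ico_self).tendsto_nhdsWithin_Ioo_right
    (Set.nonempty_Ioo.2 hxb) hbdd
  have hx := hf x ⟨le_rfl, hxb⟩
  -- Monotonicity provides some right limit of the derivative; such a limit must be the one-sided
  -- derivative at `x`, so there is no jump.
  have hder := hasDerivWithinAt_Ici_of_tendsto_deriv (s := Set.Ioo x b)
    (fun y hy => (hf y ⟨hy.1.le, hy.2⟩).differentiableWithinAt)
    hx.continuousAt.continuousWithinAt (Ioo_mem_nhdsGT hxb) hlim
  have := (uniqueDiffOn_Ici x x Set.self_mem_Ici).eq_deriv _ hder hx.hasDerivAt.hasDerivWithinAt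
  rwa [← this]

lemma tendsto_deriv_nhdsGT_of_antitoneOn {f : ℝ → ℝ} {x b : ℝ} (hxb : x < b)
    (hf : ∀ y ∈ Set.Ico x b, DifferentiableAt ℝ f y) (hanti : AntitoneOn (deriv f) (Set.Ico x b)) :
    Tendsto (deriv f) (𝓝[>] x) (𝓝 (deriv f x)) := by
  have h := tendsto_deriv_nhdsGT_of_monotoneOn (f := -f) hxb (fun y hy => (hf y hy).neg)
    (fun y hy z hz hyz => by simpa [deriv.neg] using hanti hy hz hyz)
  have h' := h.neg
  simpa [deriv.neg] using h'

/-- The mirror image of `tendsto_deriv_nhdsGT_of_monotoneOn`. -/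
lemma tendsto_deriv_nhdsLT_of_nhdsGT {f : ℝ → ℝ} {x : ℝ}
    (h : Tendsto (deriv fun y => f (-y)) (𝓝[>] (-x)) (𝓝 (deriv (fun y => f (-y)) (-x)))) :
    Tendsto (deriv f) (𝓝[<] x) (𝓝 (deriv f x)) := by
  have h' := (h.comp (tendsto_neg_nhdsLT (a := x))).neg
  simp only [deriv_comp_neg, neg_neg] at h'
  refine h'.congr fun y => ?_
  simp [deriv_comp_neg]

namespace ProfileAdmissible

variable {ρ : ℝ → ℝ → ℝ} {a m K : ℝ} (h : ProfileAdmissible ρ a m K)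
include h

/-- Oddness reflects the redescending shape to the negative axis. One-sided monotonicity at every
point is what makes the score continuous off the kinks, hence the Clarke derivative computable in
the window. -/
lemma exists_monotoneOn_or_antitoneOn {σ : ℝ} (hσ : 0 < σ) (r : ℝ) : ∃ b, r < b ∧
    (MonotoneOn (score ρ σ) {y | DifferentiableAt ℝ (ρ σ) y ∧ y ∈ Set.Ico r b} ∨
      AntitoneOn (score ρ σ) {y | DifferentiableAt ℝ (ρ σ) y ∧ y ∈ Set.Ico r b}) := by
  obtain ⟨p, hp, hmono, hanti⟩ := h.redescending σ hσ
  have hneg : ∀ {y}, DifferentiableAt ℝ (ρ σ) y → DifferentiableAt ℝ (ρ σ) (-y) := by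
    intro y hy
    have : DifferentiableAt ℝ (fun x => ρ σ (-x)) (-y) := by
      rw [differentiableAt_comp_neg, neg_neg]
      exact hy
    simpa only [h.even σ hσ] using this
  rcases le_or_gt 0 r with hr | hr
  · rcases lt_or_ge r p with hrp | hrp
    · exact ⟨p, hrp, Or.inl (hmono.mono fun y hy => ⟨hy.1, hr.trans hy.2.1, hy.2.2.le⟩)⟩
    · exact ⟨r + 1, by linarith, Or.inr (hanti.mono fun y hy => ⟨hy.1, hrp.trans hy.2.1⟩)⟩
  · rcases le_or_gt (-r) p with hrp | hrp
    · refine ⟨0, hr, Or.inl fun y hy z hz hyz => ?_⟩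
      have := hmono ⟨hneg hz.1, by linarith [hz.2.2], by linarith [hz.2.1]⟩
        ⟨hneg hy.1, by linarith [hy.2.2], by linarith [hy.2.1]⟩ (neg_le_neg hyz)
      rw [h.odd σ hσ, h.odd σ hσ] at this
      linarith
    · refine ⟨-p, by linarith, Or.inr fun y hy z hz hyz => ?_⟩
      have := hanti ⟨hneg hz.1, by linarith [hz.2.2]⟩ ⟨hneg hy.1, by linarith [hy.2.2]⟩
        (neg_le_neg hyz)
      rw [h.odd σ hσ, h.odd σ hσ] at this
      linarith

lemma eventually_differentiableAt {σ r : ℝ} (hσ : 0 < σ) (hr : DifferentiableAt ℝ (ρ σ) r) :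
    ∀ᶠ y in 𝓝 r, DifferentiableAt ℝ (ρ σ) y := by
  filter_upwards [(h.finite_kinks σ hσ).isClosed.isOpen_compl.mem_nhds
    (show r ∈ {r | ¬ DifferentiableAt ℝ (ρ σ) r}ᶜ from fun hn => hn hr)] with y hy
  exact not_not.1 hy

lemma tendsto_score_nhdsGT {σ r : ℝ} (hσ : 0 < σ) (hr : DifferentiableAt ℝ (ρ σ) r) :
    Tendsto (score ρ σ) (𝓝[>] r) (𝓝 (score ρ σ r)) := by
  obtain ⟨b, hb, hmono⟩ := h.exists_monotoneOn_or_antitoneOn hσ r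
  obtain ⟨l, u, hlu, hsub⟩ := mem_nhds_iff_exists_Ioo_subset.1 (h.eventually_differentiableAt hσ hr)
  have hd : ∀ y ∈ Set.Ico r (min b u), DifferentiableAt ℝ (ρ σ) y := fun y hy =>
    hsub ⟨hlu.1.trans_le hy.1, hy.2.trans_le (min_le_right _ _)⟩
  have hs : Set.Ico r (min b u) ⊆ {y | DifferentiableAt ℝ (ρ σ) y ∧ y ∈ Set.Ico r b} := fun y hy =>
    ⟨hd y hy, hy.1, hy.2.trans_le (min_le_left _ _)⟩
  rcases hmono with hmono | hmono
  · exact tendsto_deriv_nhdsGT_of_monotoneOn (lt_min hb hlu.2) hd (hmono.mono hs)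
  · exact tendsto_deriv_nhdsGT_of_antitoneOn (lt_min hb hlu.2) hd (hmono.mono hs)

/-- Away from its kinks, the loss is continuously differentiable. -/
lemma hasStrictDerivAt {σ r : ℝ} (hσ : 0 < σ) (hr : DifferentiableAt ℝ (ρ σ) r) :
    HasStrictDerivAt (ρ σ) (score ρ σ r) r := by
  have heven : (fun y => ρ σ (-y)) = ρ σ := funext (h.even σ hσ)
  refine hasStrictDerivAt_of_hasDerivAt_of_continuousAt
    ((h.eventually_differentiableAt hσ hr).mono fun y hy => hy.hasDerivAt) ?_
  rw [continuousAt_iff_continuous_left'_right']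
  refine ⟨tendsto_deriv_nhdsLT_of_nhdsGT ?_, h.tendsto_score_nhdsGT hσ hr⟩
  rw [heven]
  refine h.tendsto_score_nhdsGT hσ ?_
  rw [← heven, differentiableAt_comp_neg, neg_neg]
  exact hr

/-- Integrate the score: finitely many kinks do not matter to a continuous primitive. This controls
the constraints to bad triangles, whose residuals are arbitrary. -/
lemma abs_sub_le {σ : ℝ} (hσ : 0 < σ) (r s : ℝ) : |ρ σ s - ρ σ r| ≤ K * σ * |s - r| := by
  have hint : IntervalIntegrable (score ρ σ) MeasureTheory.volume r s := by
    refine (intervalIntegrable_const (c := K * σ)).mono_fun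
      (measurable_deriv (ρ σ)).aestronglyMeasurable (Eventually.of_forall fun y => ?_)
    exact (h.score_bound σ hσ y).trans (le_abs_self _)
  rw [← MeasureTheory.integral_eq_of_hasDerivAt_off_countable (ρ σ) (score ρ σ)
    (h.finite_kinks σ hσ).countable (h.continuous σ hσ).continuousOn
    (fun y hy => (not_not.1 hy.2 : DifferentiableAt ℝ (ρ σ) y).hasDerivAt) hint]
  exact intervalIntegral.norm_integral_le_of_norm_le_const (f := score ρ σ) (C := K * σ)
    fun y _ => h.score_bound σ hσ y

end ProfileAdmissible

/-! ### Flows on the clean triples of a graph -/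

section CleanTriples

variable {V : Type*} [Fintype V] [DecidableEq V]

open Classical in
/-- The triples of vertices that span no edge of `G`. -/
def cleanTriples (G : SimpleGraph V) : Finset (Finset V) :=
  Finset.univ.filter fun t => t.card = 3 ∧ ∀ i ∈ t, ∀ j ∈ t, ¬ G.Adj i j

lemma mem_cleanTriples {G : SimpleGraph V} {t : Finset V} :
    t ∈ cleanTriples G ↔ t.card = 3 ∧ ∀ i ∈ t, ∀ j ∈ t, ¬ G.Adj i j := by
  simp [cleanTriples]

open Classical in
/-- The net flow out of `t` to the clean triples that share two vertices with `t`. -/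
def netFlow (G : SimpleGraph V) (ψ : ℝ → ℝ) (X : Finset V → ℝ) (t : Finset V) : ℝ :=
  ∑ j ∈ t, ∑ r ∈ tᶜ, if insert r (t.erase j) ∈ cleanTriples G
    then ψ (X t - X (insert r (t.erase j))) else 0

/-- The largest value of `X` on the clean triples that contain `F`. -/
def faceMax (G : SimpleGraph V) (X : Finset V → ℝ) (F : Finset V) : ℝ :=
  sSup (X '' {t | t ∈ cleanTriples G ∧ F ⊆ t})

/-- Some clean triple contains `F`. -/
def Extendable (G : SimpleGraph V) (F : Finset V) : Prop := ∃ t ∈ cleanTriples G, F ⊆ t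

/-- `φ` is a nondecreasing minorant on `[0, w]` of the flow `ψ`, equal to it below the level `q`. -/
structure MonotoneMinorant (ψ φ : ℝ → ℝ) (m q w : ℝ) : Prop where
  mono : ∀ r s, 0 ≤ r → r ≤ s → s ≤ w → φ r ≤ φ s
  lower : ∀ r, 0 ≤ r → r ≤ w → m * r ≤ φ r
  le : ∀ r, 0 ≤ r → r ≤ w → φ r ≤ ψ r
  ge : ∀ r, 0 ≤ r → r ≤ w → φ r < q → ψ r ≤ φ r

lemma le_faceMax {G : SimpleGraph V} {X : Finset V → ℝ} {F t : Finset V}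
    (ht : t ∈ cleanTriples G) (hF : F ⊆ t) : X t ≤ faceMax G X F :=
  le_csSup (Set.toFinite _).bddAbove ⟨t, ⟨ht, hF⟩, rfl⟩

lemma Extendable.exists_eq_faceMax {G : SimpleGraph V} {F : Finset V} (h : Extendable G F)
    (X : Finset V → ℝ) : ∃ t ∈ cleanTriples G, F ⊆ t ∧ X t = faceMax G X F := by
  obtain ⟨u, hu, hFu⟩ := h
  have hne : (X '' {t | t ∈ cleanTriples G ∧ F ⊆ t}).Nonempty := ⟨_, u, ⟨hu, hFu⟩, rfl⟩
  obtain ⟨t, ht, hX⟩ := hne.csSup_mem (Set.toFinite _)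
  exact ⟨t, ht.1, ht.2, hX⟩

lemma Extendable.mono {G : SimpleGraph V} {F F' : Finset V} (h : Extendable G F) (hF : F' ⊆ F) :
    Extendable G F' := by
  obtain ⟨u, hu, hFu⟩ := h
  exact ⟨u, hu, hF.trans hFu⟩

lemma Extendable.faceMax_le {G : SimpleGraph V} {F F' : Finset V} (h : Extendable G F)
    (hF : F' ⊆ F) (X : Finset V → ℝ) : faceMax G X F ≤ faceMax G X F' := by
  obtain ⟨t, ht, hFt, hX⟩ := h.exists_eq_faceMax X
  exact hX ▸ le_faceMax ht (hF.trans hFt)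

lemma Extendable.faceMax_sub_le {G : SimpleGraph V} {F F' : Finset V} (h : Extendable G F)
    (h' : Extendable G F') {X : Finset V → ℝ} {w : ℝ}
    (hX : ∀ t ∈ cleanTriples G, ∀ u ∈ cleanTriples G, X t - X u ≤ w) :
    faceMax G X F - faceMax G X F' ≤ w := by
  obtain ⟨t, ht, -, hXt⟩ := h.exists_eq_faceMax X
  obtain ⟨u, hu, -, hXu⟩ := h'.exists_eq_faceMax X
  rw [← hXt, ← hXu]
  exact hX t ht u hu

lemma faceMax_of_mem {G : SimpleGraph V} {t : Finset V} (ht : t ∈ cleanTriples G)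
    (X : Finset V → ℝ) : faceMax G X t = X t := by
  have : {u | u ∈ cleanTriples G ∧ t ⊆ u} = {t} := by
    ext u
    simp only [Set.mem_ofPred_eq, Set.mem_singleton_iff]
    constructor
    · rintro ⟨hu, htu⟩
      exact (Finset.eq_of_subset_of_card_le htu
        (by rw [(mem_cleanTriples.1 hu).1, (mem_cleanTriples.1 ht).1])).symm
    · rintro rfl
      exact ⟨ht, subset_rfl⟩
  rw [faceMax, this, Set.image_singleton, csSup_singleton]

/-- Exchanging a vertex of a clean triple with a vertex that is joined to none of it. -/
lemma insert_erase_mem_cleanTriples {G : SimpleGraph V} {t : Finset V} (ht : t ∈ cleanTriples G)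
    {j r : V} (hj : j ∈ t) (hr : r ∉ t) (hadj : ∀ i ∈ t, ¬ G.Adj i r) :
    insert r (t.erase j) ∈ cleanTriples G := by
  rw [mem_cleanTriples] at ht ⊢
  refine ⟨?_, ?_⟩
  · rw [Finset.card_insert_of_notMem (fun h => hr (Finset.mem_of_mem_erase h)),
      Finset.card_erase_of_mem hj, ht.1]
  · intro a ha b hb
    rw [Finset.mem_insert, Finset.mem_erase] at ha hb
    rcases ha with rfl | ⟨-, ha⟩ <;> rcases hb with rfl | ⟨-, hb⟩
    · exact G.loopless.irrefl _
    · exact fun h => hadj b hb h.symm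
    · exact hadj a ha
    · exact ht.2 a ha b hb

/-- A vertex `r` outside of a small set extends a face `F` with little loss of the maximum, on
average over `r`. -/
lemma exists_sum_faceMax_sub_le (G : SimpleGraph V) [DecidableRel G.Adj]
    {ψ φ : ℝ → ℝ} {m q w b : ℝ} (hφ : MonotoneMinorant ψ φ m q w) (hm : 0 < m)
    (hodd : ∀ r, ψ (-r) = - ψ r) {X : Finset V → ℝ}
    (hX : ∀ t ∈ cleanTriples G, ∀ u ∈ cleanTriples G, X t - X u ≤ w)
    (hflow : ∀ t ∈ cleanTriples G, netFlow G ψ X t ≤ b)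
    {F : Finset V} (hF : Extendable G F)
    (hlt : ∀ j ∈ F, φ (faceMax G X (F.erase j) - faceMax G X F) < q) :
    ∃ B : Finset V, B.card ≤ 3 + 3 * G.maxDegree ∧ (∀ r ∉ B, r ∉ F) ∧
      (F.card ≤ 2 → ∀ r ∉ B, Extendable G (insert r F)) ∧
      (3 - (F.card : ℝ)) * ∑ r ∈ Bᶜ, φ (faceMax G X F - faceMax G X (insert r F)) ≤
        b + Fintype.card V * ∑ j ∈ F, φ (faceMax G X (F.erase j) - faceMax G X F) := by
  classical
  obtain ⟨t, ht, hFt, hXt⟩ := hF.exists_eq_faceMax X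
  have htcard : t.card = 3 := (mem_cleanTriples.1 ht).1
  -- For `r` outside `B`, every exchange of a vertex of `t` for `r` is again clean.
  set B : Finset V := t ∪ t.biUnion fun i => G.neighborFinset i with hB
  have hBr : ∀ r ∉ B, r ∉ t ∧ ∀ i ∈ t, ¬ G.Adj i r := by
    intro r hr
    simpa [hB] using hr
  have hsub : ∀ {j r : V}, j ∈ t \ F → insert r F ⊆ insert r (t.erase j) := by
    intro j r hj
    rw [Finset.mem_sdiff] at hj
    refine Finset.insert_subset_insert _ fun i hi => Finset.mem_erase.2 ⟨?_, hFt hi⟩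
    rintro rfl
    exact hj.2 hi
  have hnbr : ∀ r ∉ B, ∀ j ∈ t, insert r (t.erase j) ∈ cleanTriples G := fun r hr j hj =>
    insert_erase_mem_cleanTriples ht hj (hBr r hr).1 (hBr r hr).2
  have hdiff : ((t \ F).card : ℝ) = 3 - F.card := by
    rw [Finset.card_sdiff_of_subset hFt, htcard,
      Nat.cast_sub (htcard ▸ Finset.card_le_card hFt)]
    simp
  have hφ0 : ∀ r, 0 ≤ r → r ≤ w → 0 ≤ φ r := fun r h0 h1 =>
    (mul_nonneg hm.le h0).trans (hφ.lower r h0 h1)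
  refine ⟨B, ?_, fun r hr h => (hBr r hr).1 (hFt h), ?_, ?_⟩
  · refine (Finset.card_union_le _ _).trans ?_
    rw [htcard]
    refine Nat.add_le_add_left ?_ 3
    refine Finset.card_biUnion_le.trans ((Finset.sum_le_card_nsmul t _ G.maxDegree ?_).trans ?_)
    · intro i _
      rw [G.card_neighborFinset_eq_degree]
      exact G.degree_le_maxDegree i
    · rw [htcard, smul_eq_mul]
  · intro hcard r hr
    obtain ⟨j, hj⟩ : (t \ F).Nonempty := by
      rw [← Finset.card_pos, Finset.card_sdiff_of_subset hFt, htcard]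
      omega
    exact ⟨_, hnbr r hr j (Finset.mem_sdiff.1 hj).1, hsub hj⟩
  · have hsplit := hflow t ht
    rw [netFlow, ← Finset.sum_sdiff hFt] at hsplit
    -- Exchanges of `j ∈ F`: the new triple still contains `F.erase j`, so it exceeds `X t` by at
    -- most the rise of the face maximum. By `hlt` that level is below `q`, where `ψ ≤ φ` is
    -- available.
    have hin : -(Fintype.card V * ∑ j ∈ F, φ (faceMax G X (F.erase j) - faceMax G X F)) ≤
        ∑ j ∈ F, ∑ r ∈ tᶜ, if insert r (t.erase j) ∈ cleanTriples G
          then ψ (X t - X (insert r (t.erase j))) else 0 := by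
      rw [Finset.mul_sum, ← Finset.sum_neg_distrib]
      refine Finset.sum_le_sum fun j hj => ?_
      have hd0 : 0 ≤ faceMax G X (F.erase j) - faceMax G X F :=
        sub_nonneg.2 (hF.faceMax_le (Finset.erase_subset _ _) X)
      have hd1 : faceMax G X (F.erase j) - faceMax G X F ≤ w :=
        (hF.mono (Finset.erase_subset _ _)).faceMax_sub_le hF hX
      have hc := hφ0 _ hd0 hd1
      have hcard : ((tᶜ : Finset V).card : ℝ) ≤ Fintype.card V := by
        exact_mod_cast Finset.card_le_univ _
      calc -(Fintype.card V * φ (faceMax G X (F.erase j) - faceMax G X F))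
          ≤ ((tᶜ : Finset V).card : ℝ) * -φ (faceMax G X (F.erase j) - faceMax G X F) := by
            nlinarith
        _ = ∑ r ∈ tᶜ, -φ (faceMax G X (F.erase j) - faceMax G X F) := by
            rw [Finset.sum_const, nsmul_eq_mul]
        _ ≤ _ := by
            refine Finset.sum_le_sum fun r _ => ?_
            split_ifs with hu
            · have hle : X (insert r (t.erase j)) ≤ faceMax G X (F.erase j) :=
                le_faceMax hu ((Finset.erase_subset_erase j hFt).trans (Finset.subset_insert _ _))
              rcases le_total (X (insert r (t.erase j))) (X t) with h | h
              · have h0 := sub_nonneg.2 h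
                have h1 := hX t ht _ hu
                linarith [hφ0 _ h0 h1, hφ.le _ h0 h1]
              · have h0 := sub_nonneg.2 h
                have h1 := hX _ hu t ht
                have h2 : φ (X (insert r (t.erase j)) - X t) ≤
                    φ (faceMax G X (F.erase j) - faceMax G X F) :=
                  hφ.mono _ _ h0 (by rw [hXt]; linarith) hd1
                have h3 := hφ.ge _ h0 h1 (h2.trans_lt (hlt j hj))
                rw [← neg_sub (X (insert r (t.erase j))) (X t), hodd]
                linarith
            · linarith
    -- Exchanges of `j ∈ t \ F`: the new triple contains `insert r F`, hence lies below `X t` by at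
    -- least the drop of the face maximum. Exchanges with `r ∈ B` may be discarded, since their flow
    -- is outward too.
    have hout : (3 - (F.card : ℝ)) * ∑ r ∈ Bᶜ, φ (faceMax G X F - faceMax G X (insert r F)) ≤
        ∑ j ∈ t \ F, ∑ r ∈ tᶜ, if insert r (t.erase j) ∈ cleanTriples G
          then ψ (X t - X (insert r (t.erase j))) else 0 := by
      rw [← hdiff, ← nsmul_eq_mul, ← Finset.sum_const]
      refine Finset.sum_le_sum fun j hj => ?_
      have hjt := (Finset.mem_sdiff.1 hj).1
      have hle : ∀ r, insert r (t.erase j) ∈ cleanTriples G → X (insert r (t.erase j)) ≤ X t :=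
        fun r hu => hXt ▸ le_faceMax hu ((Finset.subset_insert _ _).trans (hsub hj))
      have hnn : ∀ r, insert r (t.erase j) ∈ cleanTriples G →
          φ (X t - X (insert r (t.erase j))) ≤ ψ (X t - X (insert r (t.erase j))) :=
        fun r hu => hφ.le _ (sub_nonneg.2 (hle r hu)) (hX t ht _ hu)
      have hBt : Bᶜ ⊆ tᶜ := Finset.compl_subset_compl.2 Finset.subset_union_left
      refine le_trans ?_ (Finset.sum_le_sum_of_subset_of_nonneg hBt ?_)
      · refine Finset.sum_le_sum fun r hr => ?_
        have hu := hnbr r (Finset.mem_compl.1 hr) j hjt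
        rw [if_pos hu]
        refine le_trans ?_ (hnn r hu)
        have hext : Extendable G (insert r F) := ⟨_, hu, hsub hj⟩
        refine hφ.mono _ _ (sub_nonneg.2 (hext.faceMax_le (Finset.subset_insert _ _) X)) ?_
          (hX t ht _ hu)
        have := le_faceMax (X := X) hu (hsub hj)
        rw [hXt]
        linarith
      · intro r _ _
        split_ifs with hu
        · exact (hφ0 _ (sub_nonneg.2 (hle r hu)) (hX t ht _ hu)).trans (hnn r hu)
        · exact le_rfl
    linarith

end CleanTriples

/-! ### From small net flows to small oscillation. -/

section Oscillation

variable {V : Type*} [Fintype V] [DecidableEq V]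

lemma netFlow_neg (G : SimpleGraph V) {ψ : ℝ → ℝ} (hodd : ∀ r, ψ (-r) = - ψ r)
    (X : Finset V → ℝ) (t : Finset V) : netFlow G ψ (-X) t = - netFlow G ψ X t := by
  simp only [netFlow, ← Finset.sum_neg_distrib]
  refine Finset.sum_congr rfl fun j _ => Finset.sum_congr rfl fun r _ => ?_
  split_ifs
  · rw [← hodd]
    congr 1
    simp only [Pi.neg_apply]
    ring
  · simp

/-- The flow levels of the losses of the maximum and of the minimum of `X` when passing from the
clean triples that contain `F` to those that contain `F'`, added up. -/
def faceGap (G : SimpleGraph V) (φ : ℝ → ℝ) (X : Finset V → ℝ) (F F' : Finset V) : ℝ :=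
  φ (faceMax G X F - faceMax G X F') + φ (faceMax G (-X) F - faceMax G (-X) F')

section

variable {G : SimpleGraph V} {ψ φ : ℝ → ℝ} {m q w : ℝ} {X : Finset V → ℝ}

lemma neg_sub_neg_le (hX : ∀ t ∈ cleanTriples G, ∀ u ∈ cleanTriples G, X t - X u ≤ w) :
    ∀ t ∈ cleanTriples G, ∀ u ∈ cleanTriples G, (-X) t - (-X) u ≤ w := by
  intro t ht u hu
  have := hX u hu t ht
  simp only [Pi.neg_apply]
  linarith

lemma MonotoneMinorant.mul_faceMax_sub_le (hφ : MonotoneMinorant ψ φ m q w)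
    (hX : ∀ t ∈ cleanTriples G, ∀ u ∈ cleanTriples G, X t - X u ≤ w) {F F' : Finset V}
    (h : Extendable G F') (hF : F ⊆ F') :
    m * (faceMax G X F - faceMax G X F') ≤ φ (faceMax G X F - faceMax G X F') :=
  hφ.lower _ (sub_nonneg.2 (h.faceMax_le hF X)) ((h.mono hF).faceMax_sub_le h hX)

lemma MonotoneMinorant.faceMax_sub_nonneg (hφ : MonotoneMinorant ψ φ m q w) (hm : 0 < m)
    (hX : ∀ t ∈ cleanTriples G, ∀ u ∈ cleanTriples G, X t - X u ≤ w) {F F' : Finset V}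
    (h : Extendable G F') (hF : F ⊆ F') : 0 ≤ φ (faceMax G X F - faceMax G X F') :=
  (mul_nonneg hm.le (sub_nonneg.2 (h.faceMax_le hF X))).trans (hφ.mul_faceMax_sub_le hX h hF)

/-- Two-sided form of `exists_sum_faceMax_sub_le`. -/
lemma exists_sum_faceGap_le [DecidableRel G.Adj] {b : ℝ} (hφ : MonotoneMinorant ψ φ m q w)
    (hm : 0 < m) (hodd : ∀ r, ψ (-r) = - ψ r)
    (hX : ∀ t ∈ cleanTriples G, ∀ u ∈ cleanTriples G, X t - X u ≤ w)
    (hflow : ∀ t ∈ cleanTriples G, |netFlow G ψ X t| ≤ b)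
    {F : Finset V} (hF : Extendable G F) (hlt : ∀ j ∈ F, faceGap G φ X (F.erase j) F < q) :
    ∃ B : Finset V, B.card ≤ 6 + 6 * G.maxDegree ∧ (∀ r ∉ B, r ∉ F) ∧
      (F.card ≤ 2 → ∀ r ∉ B, Extendable G (insert r F)) ∧
      (F.card ≤ 2 → (3 - (F.card : ℝ)) * ∑ r ∈ Bᶜ, faceGap G φ X F (insert r F) ≤
        2 * b + Fintype.card V * ∑ j ∈ F, faceGap G φ X (F.erase j) F) := by
  have hX' := neg_sub_neg_le hX
  have hn := fun j => hφ.faceMax_sub_nonneg hm hX hF (Finset.erase_subset j F)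
  have hn' := fun j => hφ.faceMax_sub_nonneg hm hX' hF (Finset.erase_subset j F)
  obtain ⟨B₁, h₁, hd₁, he₁, hs₁⟩ := exists_sum_faceMax_sub_le G hφ hm hodd hX
    (fun t ht => (abs_le.1 (hflow t ht)).2) hF (fun j hj => by
      have := hlt j hj
      rw [faceGap] at this
      linarith [hn' j])
  obtain ⟨B₂, h₂, -, he₂, hs₂⟩ := exists_sum_faceMax_sub_le (b := b) G hφ hm hodd hX'
    (fun t ht => by
      rw [netFlow_neg G hodd]
      linarith [(abs_le.1 (hflow t ht)).1]) hF (fun j hj => by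
      have := hlt j hj
      rw [faceGap] at this
      linarith [hn j])
  refine ⟨B₁ ∪ B₂, (Finset.card_union_le _ _).trans (by omega),
    fun r hr => hd₁ r fun h => hr (Finset.mem_union_left _ h),
    fun hc r hr => he₁ hc r fun h => hr (Finset.mem_union_left _ h), fun hc => ?_⟩
  have hc' : (0 : ℝ) ≤ 3 - F.card := by
    have : (F.card : ℝ) ≤ 2 := by exact_mod_cast hc
    linarith
  have hle₁ : ∑ r ∈ (B₁ ∪ B₂)ᶜ, φ (faceMax G X F - faceMax G X (insert r F)) ≤
      ∑ r ∈ B₁ᶜ, φ (faceMax G X F - faceMax G X (insert r F)) :=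
    Finset.sum_le_sum_of_subset_of_nonneg
      (Finset.compl_subset_compl.2 Finset.subset_union_left) fun r hr _ =>
        hφ.faceMax_sub_nonneg hm hX (he₁ hc r (Finset.mem_compl.1 hr)) (Finset.subset_insert _ _)
  have hle₂ : ∑ r ∈ (B₁ ∪ B₂)ᶜ, φ (faceMax G (-X) F - faceMax G (-X) (insert r F)) ≤
      ∑ r ∈ B₂ᶜ, φ (faceMax G (-X) F - faceMax G (-X) (insert r F)) :=
    Finset.sum_le_sum_of_subset_of_nonneg
      (Finset.compl_subset_compl.2 Finset.subset_union_right) fun r hr _ =>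
        hφ.faceMax_sub_nonneg hm hX' (he₂ hc r (Finset.mem_compl.1 hr)) (Finset.subset_insert _ _)
  simp only [faceGap, Finset.sum_add_distrib, mul_add]
  linarith [mul_le_mul_of_nonneg_left hle₁ hc', mul_le_mul_of_nonneg_left hle₂ hc']

lemma faceGap_nonneg (hφ : MonotoneMinorant ψ φ m q w) (hm : 0 < m)
    (hX : ∀ t ∈ cleanTriples G, ∀ u ∈ cleanTriples G, X t - X u ≤ w) {F F' : Finset V}
    (h : Extendable G F') (hF : F ⊆ F') : 0 ≤ faceGap G φ X F F' :=
  add_nonneg (hφ.faceMax_sub_nonneg hm hX h hF)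
    (hφ.faceMax_sub_nonneg hm (neg_sub_neg_le hX) h hF)

/-- The oscillation of `X` over the clean triples that contain `F`. -/
def faceOsc (G : SimpleGraph V) (X : Finset V → ℝ) (F : Finset V) : ℝ :=
  faceMax G X F + faceMax G (-X) F

lemma mul_faceOsc_sub_le (hφ : MonotoneMinorant ψ φ m q w)
    (hX : ∀ t ∈ cleanTriples G, ∀ u ∈ cleanTriples G, X t - X u ≤ w) {F F' : Finset V}
    (h : Extendable G F') (hF : F ⊆ F') :
    m * (faceOsc G X F - faceOsc G X F') ≤ faceGap G φ X F F' := by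
  have h₁ := hφ.mul_faceMax_sub_le hX h hF
  have h₂ := hφ.mul_faceMax_sub_le (neg_sub_neg_le hX) h hF
  rw [faceOsc, faceOsc, faceGap]
  linarith

/-- The descent ends at a full clean triple, on which the oscillation vanishes. -/
lemma mul_faceOsc_le (hφ : MonotoneMinorant ψ φ m q w)
    (hX : ∀ t ∈ cleanTriples G, ∀ u ∈ cleanTriples G, X t - X u ≤ w) {F t : Finset V}
    (ht : t ∈ cleanTriples G) (hF : F ⊆ t) : m * faceOsc G X F ≤ faceGap G φ X F t := by
  have h := mul_faceOsc_sub_le hφ hX ⟨t, ht, subset_rfl⟩ hF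
  rwa [show faceOsc G X t = 0 by simp [faceOsc, faceMax_of_mem ht], sub_zero] at h

end

/-- Markov's inequality, counting the exceptional vertices at each level. -/
lemma mul_card_filter_lt_le {ι : Type*} {s : Finset ι} {f : ι → ℝ} {c S : ℝ}
    (hf : ∀ i ∈ s, 0 ≤ f i) (hS : ∑ i ∈ s, f i ≤ S) :
    c * (s.filter fun i => c < f i).card ≤ S := by
  refine le_trans ?_ ((Finset.sum_le_sum_of_subset_of_nonneg (Finset.filter_subset (fun i => c < f i) s)
    fun i hi _ => hf i hi).trans hS)
  rw [mul_comm, ← nsmul_eq_mul]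
  exact Finset.card_nsmul_le_sum _ _ _ fun i hi => (Finset.mem_filter.1 hi).2.le

/-- If out-degrees are less than about half of the number of vertices, then some two vertices are
joined in neither direction. -/
lemma exists_ne_notMem_notMem {ι : Type*} [DecidableEq ι] {A : Finset ι} {D : ι → Finset ι} {k : ℕ}
    (hD : ∀ p ∈ A, (D p).card ≤ k) (hA : 2 * k + 1 < A.card) :
    ∃ p ∈ A, ∃ q ∈ A, p ≠ q ∧ q ∉ D p ∧ p ∉ D q := by
  by_contra! hcon
  -- Otherwise every ordered pair of distinct points is an arc or a reversed arc, so `|A| (|A| - 1)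
  -- ≤ 2 k |A|`.
  have hsub : A.offDiag ⊆ A.biUnion (fun p => (D p).image fun q => (p, q)) ∪
      A.biUnion (fun p => (D p).image fun q => (q, p)) := by
    rintro ⟨p, q⟩ hpq
    obtain ⟨hp, hq, hne⟩ := Finset.mem_offDiag.1 hpq
    by_cases h : q ∈ D p
    · refine Finset.mem_union_left _ (Finset.mem_biUnion.2 ⟨p, hp, ?_⟩)
      exact Finset.mem_image.2 ⟨q, h, rfl⟩
    · refine Finset.mem_union_right _ (Finset.mem_biUnion.2 ⟨q, hq, ?_⟩)
      exact Finset.mem_image.2 ⟨p, hcon p hp q hq hne h, rfl⟩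
  have hcard := (Finset.card_le_card hsub).trans (Finset.card_union_le _ _)
  have h₁ : (A.biUnion (fun p => (D p).image fun q => (p, q))).card ≤ A.card * k :=
    Finset.card_biUnion_le_card_mul _ _ _ fun p hp => Finset.card_image_le.trans (hD p hp)
  have h₂ : (A.biUnion (fun p => (D p).image fun q => (q, p))).card ≤ A.card * k :=
    Finset.card_biUnion_le_card_mul _ _ _ fun p hp => Finset.card_image_le.trans (hD p hp)
  rw [Finset.offDiag_card] at hcard
  have h₃ : A.card * A.card ≤ A.card * (2 * k + 1) := by
    rw [mul_add, mul_one, mul_left_comm]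
    omega
  exact absurd (Nat.le_of_mul_le_mul_left h₃ (by omega)) (by omega)

lemma sub_le_faceOsc_empty {G : SimpleGraph V} {X : Finset V → ℝ} {t u : Finset V}
    (ht : t ∈ cleanTriples G) (hu : u ∈ cleanTriples G) : X t - X u ≤ faceOsc G X ∅ := by
  have h₁ := le_faceMax (X := X) ht (Finset.empty_subset _)
  have h₂ := le_faceMax (X := -X) hu (Finset.empty_subset _)
  rw [Pi.neg_apply] at h₂
  rw [faceOsc]
  linarith

/-- The oscillation of a function on the clean triples whose net flows are small. -/
theorem mul_sub_le_of_abs_netFlow_le (G : SimpleGraph V) [DecidableRel G.Adj]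
    {ψ φ : ℝ → ℝ} {m q w β : ℝ} (hφ : MonotoneMinorant ψ φ m q w) (hm : 0 < m)
    (hodd : ∀ r, ψ (-r) = - ψ r) {X : Finset V → ℝ}
    (hX : ∀ t ∈ cleanTriples G, ∀ u ∈ cleanTriples G, X t - X u ≤ w)
    (hflow : ∀ t ∈ cleanTriples G, |netFlow G ψ X t| ≤ Fintype.card V * β)
    (hβ : 0 < β) (hq : 32 * β ≤ q) (hcard : 1000 ≤ Fintype.card V)
    (hdeg : 200 * G.maxDegree ≤ Fintype.card V) {t u : Finset V}
    (ht : t ∈ cleanTriples G) (hu : u ∈ cleanTriples G) : m * (X t - X u) ≤ 32 * β := by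
  classical
  set n : ℝ := (Fintype.card V : ℝ) with hn
  have hn0 : (1000 : ℝ) ≤ n := by rw [hn]; exact_mod_cast hcard
  have hdeg' : 200 * (G.maxDegree : ℝ) ≤ n := by rw [hn]; exact_mod_cast hdeg
  have hstep := fun {F : Finset V} => exists_sum_faceGap_le (F := F) hφ hm hodd hX hflow
  have hB : ∀ {B : Finset V}, B.card ≤ 6 + 6 * G.maxDegree → (B.card : ℝ) ≤ 6 + 3 / 100 * n := by
    intro B h
    have : (B.card : ℝ) ≤ 6 + 6 * G.maxDegree := by exact_mod_cast h
    linarith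
  have hcompl : ∀ B : Finset V, ((Bᶜ : Finset V).card : ℝ) = n - B.card := fun B => by
    rw [Finset.card_compl, Nat.cast_sub (Finset.card_le_univ B)]
  -- Most vertices lose little against the whole.
  obtain ⟨B₀, hB₀, -, he₀, hs₀⟩ := hstep (F := ∅) ⟨t, ht, Finset.empty_subset _⟩ (by simp)
  replace he₀ : ∀ r ∉ B₀, Extendable G {r} := he₀ (by simp)
  replace hs₀ : ∑ r ∈ B₀ᶜ, faceGap G φ X ∅ {r} ≤ 2 / 3 * (n * β) := by
    have := hs₀ (by simp)
    simp only [Finset.card_empty, Nat.cast_zero, sub_zero, Finset.sum_empty, mul_zero,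
      insert_empty_eq, add_zero] at this
    linarith
  -- The threshold is three times the average bound `2 β / 3`, so at most `n / 3` vertices fail it;
  -- `B₀` removes at most `3 n / 100 + 6` more.
  set A := B₀ᶜ.filter fun r => faceGap G φ X ∅ {r} ≤ 2 * β with hA
  have hAcard : 63 / 100 * n - 6 ≤ A.card := by
    have h₁ := mul_card_filter_lt_le (c := 2 * β) (fun r hr => faceGap_nonneg hφ hm hX
      (he₀ r (Finset.mem_compl.1 hr)) (Finset.empty_subset _)) hs₀
    have h₂ := Finset.card_filter_add_card_filter_not (s := B₀ᶜ)
      (fun r => faceGap G φ X ∅ {r} ≤ 2 * β)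
    simp only [not_le] at h₂
    have h₃ : (A.card : ℝ) + (B₀ᶜ.filter fun r => 2 * β < faceGap G φ X ∅ {r}).card =
        n - B₀.card := by
      rw [← hcompl]
      exact_mod_cast h₂
    have h₄ := hB hB₀
    have h₅ : ((B₀ᶜ.filter fun r => 2 * β < faceGap G φ X ∅ {r}).card : ℝ) ≤ n / 3 :=
      le_of_mul_le_mul_left (by linarith) hβ
    linarith
  have hAe : ∀ p ∈ A, Extendable G {p} ∧ faceGap G φ X ∅ {p} ≤ 2 * β := fun p hp =>
    ⟨he₀ p (Finset.mem_compl.1 (Finset.mem_filter.1 hp).1), (Finset.mem_filter.1 hp).2⟩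
  -- For such a vertex `p`, most pairs `{p, r}` lose little against `p`.
  have hpair : ∀ p ∈ A, ∃ D : Finset V, (D.card : ℝ) ≤ 28 / 100 * n + 6 ∧
      ∀ r ∉ D, Extendable G {r, p} ∧ faceGap G φ X {p} {r, p} ≤ 8 * β := by
    intro p hp
    obtain ⟨hep, hgp⟩ := hAe p hp
    obtain ⟨B, hBc, -, he, hs⟩ := hstep hep (by
      intro j hj
      rw [Finset.mem_singleton.1 hj, Finset.erase_singleton]
      linarith)
    replace he : ∀ r ∉ B, Extendable G {r, p} := he (by simp)
    replace hs : ∑ r ∈ Bᶜ, faceGap G φ X {p} {r, p} ≤ 2 * (n * β) := by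
      have := hs (by simp)
      simp only [Finset.card_singleton, Nat.cast_one, Finset.sum_singleton,
        Finset.erase_singleton] at this
      nlinarith
    -- The threshold is four times the average bound `2 β`, so at most `n / 4` vertices fail it.
    have h₁ := mul_card_filter_lt_le (c := 8 * β) (fun r hr => faceGap_nonneg hφ hm hX
      (he r (Finset.mem_compl.1 hr)) (Finset.subset_insert _ _)) hs
    have h₂ : ((Bᶜ.filter fun r => 8 * β < faceGap G φ X {p} {r, p}).card : ℝ) ≤ n / 4 :=
      le_of_mul_le_mul_left (by linarith) hβ
    refine ⟨B ∪ Bᶜ.filter fun r => 8 * β < faceGap G φ X {p} {r, p}, ?_, fun r hr => ?_⟩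
    · have h₃ : ((B ∪ Bᶜ.filter fun r => 8 * β < faceGap G φ X {p} {r, p}).card : ℝ) ≤
          B.card + (Bᶜ.filter fun r => 8 * β < faceGap G φ X {p} {r, p}).card := by
        exact_mod_cast Finset.card_union_le _ _
      linarith [hB hBc]
    · have hrB : r ∉ B := fun h => hr (Finset.mem_union_left _ h)
      refine ⟨he r hrB, not_lt.1 fun h => hr (Finset.mem_union_right _ ?_)⟩
      exact Finset.mem_filter.2 ⟨Finset.mem_compl.2 hrB, h⟩
  choose! D hDcard hD using hpair
  -- The pair must be good from both ends, because both erasures of the face `{s, p}` enter the next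
  -- estimate. There is room: `0.63 n - 6` exceeds `2 (0.28 n + 6) + 1` for `n ≥ 1000`.
  obtain ⟨p, hp, s, hs, hne, hsp, hps⟩ : ∃ p ∈ A, ∃ s ∈ A, p ≠ s ∧ s ∉ D p ∧ p ∉ D s := by
    refine exists_ne_notMem_notMem (k := ⌊28 / 100 * n + 6⌋₊)
      (fun p hp => Nat.le_floor (hDcard p hp)) ?_
    have : (⌊28 / 100 * n + 6⌋₊ : ℝ) ≤ 28 / 100 * n + 6 := Nat.floor_le (by linarith)
    have : (2 * ⌊28 / 100 * n + 6⌋₊ + 1 : ℝ) < A.card := by linarith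
    exact_mod_cast this
  obtain ⟨hesp, hgp⟩ := hD p hp s hsp
  obtain ⟨-, hgs⟩ := hD s hs p hps
  rw [Finset.pair_comm] at hgs
  -- Most triples `{r, s, p}` meet both the maximum and the minimum over `{s, p}`.
  have her : ({s, p} : Finset V).erase s = {p} := Finset.erase_insert (by simpa using hne.symm)
  have her' : ({s, p} : Finset V).erase p = {s} := by
    rw [Finset.pair_comm]
    exact Finset.erase_insert (by simpa using hne)
  obtain ⟨B, hBc, hBF, he, hsum⟩ := hstep hesp (by
    intro j hj
    rw [Finset.mem_insert, Finset.mem_singleton] at hj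
    rcases hj with rfl | rfl
    · rw [her]
      linarith
    · rw [her']
      linarith)
  have hcard2 : ({s, p} : Finset V).card = 2 := Finset.card_pair hne.symm
  replace he := he hcard2.le
  replace hsum := hsum hcard2.le
  rw [hcard2, Finset.sum_pair hne.symm, her, her'] at hsum
  have hosc : ((Bᶜ : Finset V).card : ℝ) * (m * faceOsc G X {s, p}) ≤
      ∑ r ∈ Bᶜ, faceGap G φ X {s, p} (insert r {s, p}) := by
    rw [← nsmul_eq_mul]
    refine Finset.card_nsmul_le_sum _ _ _ fun r hr => ?_
    have hr' := Finset.mem_compl.1 hr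
    refine mul_faceOsc_le hφ hX ?_ (Finset.subset_insert _ _)
    obtain ⟨v, hv, hrv⟩ := he r hr'
    have hveq : insert r {s, p} = v := Finset.eq_of_subset_of_card_le hrv (by
      rw [(mem_cleanTriples.1 hv).1, Finset.card_insert_of_notMem (hBF r hr'), hcard2])
    exact hveq ▸ hv
  have hgap : m * faceOsc G X {s, p} ≤ 20 * β := by
    rw [hcompl] at hosc
    have h₁ := hB hBc
    push_cast at hsum
    -- Here 18 = 2 + 8 + 8: the net flows of `X` and `-X`, and the two erasures. As `n - B.card ≥
    -- 0.97 n - 6`, the quotient stays below `20 β`.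
    have h₂ : (n - B.card) * (m * faceOsc G X {s, p}) ≤ 18 * (n * β) := by nlinarith
    by_contra! hcon
    nlinarith
  have h₁ := mul_faceOsc_sub_le hφ hX (hAe p hp).1 (Finset.empty_subset _)
  have h₂ := mul_faceOsc_sub_le hφ hX hesp (F := {p}) (Finset.subset_insert _ _)
  have h₃ := mul_le_mul_of_nonneg_left (sub_le_faceOsc_empty (X := X) ht hu) hm.le
  -- The three stages add up to `2 β + 8 β + 20 β`, within `32 β`.
  linarith [(hAe p hp).2]

end Oscillation

/-! ### The truncated score as a monotone minorant. -/

namespace ProfileAdmissible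

variable {ρ : ℝ → ℝ → ℝ} {a m K : ℝ} (h : ProfileAdmissible ρ a m K)
include h

lemma mul_le_score {σ : ℝ} (hσ : 0 < σ) {r : ℝ} (hr : 0 ≤ r) (hr' : r ≤ a * σ) :
    m * r ≤ score ρ σ r := by
  rcases hr.eq_or_lt with rfl | hr
  · rw [h.zero σ hσ, mul_zero]
  · rw [← le_div_iff₀ hr]
    exact h.window_slope σ hσ r hr.ne' (by rwa [abs_of_pos hr])

/-- Below the level `m a σ`, a score of redescending shape is nondecreasing on the window. -/
lemma monotoneMinorant (ha : 0 < a) (hm : 0 < m) {σ : ℝ} (hσ : 0 < σ) :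
    MonotoneMinorant (score ρ σ) (fun r => min (score ρ σ r) (m * (a * σ))) m (m * (a * σ))
      (a * σ) where
  mono r s hr hrs hs := by
    obtain ⟨p, -, hmono, hanti⟩ := h.redescending σ hσ
    have hd : ∀ y, 0 ≤ y → y ≤ a * σ → DifferentiableAt ℝ (ρ σ) y := fun y hy hy' =>
      h.differentiable_window σ hσ y (by rwa [abs_of_nonneg hy])
    rcases le_or_gt s p with hsp | hsp
    · exact min_le_min_right _ (hmono ⟨hd r hr (hrs.trans hs), hr, hrs.trans hsp⟩
        ⟨hd s (hr.trans hrs) hs, hr.trans hrs, hsp⟩ hrs)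
    -- Past its peak the score decreases, yet up to the end of the window it stays above its end
    -- value, which is at least the cap; so the truncation is constant there.
    · have h0 : 0 ≤ a * σ := (mul_pos ha hσ).le
      have h1 := hanti ⟨hd s (hr.trans hrs) hs, hsp.le⟩ ⟨hd _ h0 le_rfl, hsp.le.trans hs⟩ hs
      exact le_min ((min_le_right _ _).trans ((h.mul_le_score hσ h0 le_rfl).trans h1))
        (min_le_right _ _)
  lower r hr hr' := le_min (h.mul_le_score hσ hr hr') (mul_le_mul_of_nonneg_left hr' hm.le)
  le r _ _ := min_le_left _ _
  ge r _ _ hr := (le_min le_rfl ((min_lt_iff.1 hr).resolve_right (lt_irrefl _)).le)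

end ProfileAdmissible

/-! ### Triples that share two vertices -/

section Exchange

variable {V : Type*} [DecidableEq V]

lemma inter_insert_erase {t : Finset V} {j r : V} (hr : r ∉ t) :
    t ∩ insert r (t.erase j) = t.erase j := by
  rw [Finset.inter_insert_of_notMem hr, Finset.inter_eq_right]
  exact Finset.erase_subset _ _

lemma exists_eq_insert_erase {t u : Finset V} (ht : t.card = 3) (hu : u.card = 3)
    (htu : (t ∩ u).card = 2) : ∃ j ∈ t, ∃ r ∉ t, insert r (t.erase j) = u := by
  have h₁ := Finset.card_sdiff_add_card_inter t u
  have h₂ := Finset.card_sdiff_add_card_inter u t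
  rw [Finset.inter_comm] at h₂
  obtain ⟨j, hj⟩ := Finset.card_eq_one.1 (show (t \ u).card = 1 by omega)
  obtain ⟨r, hr⟩ := Finset.card_eq_one.1 (show (u \ t).card = 1 by omega)
  have hj' := Finset.mem_sdiff.1 (hj ▸ Finset.mem_singleton_self j)
  have hr' := Finset.mem_sdiff.1 (hr ▸ Finset.mem_singleton_self r)
  refine ⟨j, hj'.1, r, hr'.2, ?_⟩
  ext i
  have h₃ : i ∈ t \ u ↔ i = j := by rw [hj, Finset.mem_singleton]
  have h₄ : i ∈ u \ t ↔ i = r := by rw [hr, Finset.mem_singleton]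
  rw [Finset.mem_sdiff] at h₃ h₄
  rw [Finset.mem_insert, Finset.mem_erase]
  tauto

variable [Fintype V]

lemma netFlow_eq_sum (G : SimpleGraph V) (ψ : ℝ → ℝ) (X : Finset V → ℝ) {t : Finset V}
    (ht : t.card = 3) : netFlow G ψ X t =
      ∑ u ∈ (cleanTriples G).filter fun u => (t ∩ u).card = 2, ψ (X t - X u) := by
  classical
  rw [netFlow, ← Finset.sum_product' t tᶜ fun j r => if insert r (t.erase j) ∈ cleanTriples G
    then ψ (X t - X (insert r (t.erase j))) else 0, ← Finset.sum_filter]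
  refine Finset.sum_nbij (fun x => insert x.2 (t.erase x.1)) ?_ ?_ ?_ fun _ _ => rfl
  · rintro ⟨j, r⟩ hx
    simp only [Finset.mem_filter, Finset.mem_product, Finset.mem_compl] at hx ⊢
    refine ⟨hx.2, ?_⟩
    rw [inter_insert_erase hx.1.2, Finset.card_erase_of_mem hx.1.1, ht]
  · rintro ⟨j, r⟩ hx ⟨j', r'⟩ hx' heq
    simp only [Finset.coe_filter, Set.mem_ofPred_eq, Finset.mem_product, Finset.mem_compl] at hx hx'
    simp only at heq
    have h₁ : r ∈ insert r' (t.erase j') := heq ▸ Finset.mem_insert_self _ _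
    have h₂ : j ∉ insert r' (t.erase j') := by
      rw [← heq, Finset.mem_insert, Finset.mem_erase]
      rintro (rfl | h)
      · exact hx.1.2 hx.1.1
      · exact h.1 rfl
    have hr : r = r' := (Finset.mem_insert.1 h₁).resolve_right
      fun h => hx.1.2 (Finset.mem_of_mem_erase h)
    have hj : j = j' := by
      by_contra hne
      exact h₂ (Finset.mem_insert_of_mem (Finset.mem_erase.2 ⟨hne, hx.1.1⟩))
    rw [hr, hj]
  · intro u hu
    obtain ⟨hu, htu⟩ := Finset.mem_filter.1 (Finset.mem_coe.1 hu)
    obtain ⟨j, hj, r, hr, rfl⟩ := exists_eq_insert_erase ht (mem_cleanTriples.1 hu).1 htu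
    exact ⟨(j, r), by simp [hj, hr, hu], rfl⟩

/-- An unclean neighbour arises by removing some `j` and adding a `G`-neighbour `r` of a remaining
vertex `i`: six ordered pairs `(i, j)`, at most `G.maxDegree` choices of `r` for each. -/
lemma card_unclean_neighbors_le (G : SimpleGraph V) [DecidableRel G.Adj] {t : Finset V}
    (ht : t ∈ cleanTriples G) {S : Finset (Finset V)}
    (hS : ∀ u ∈ S, u.card = 3 ∧ (t ∩ u).card = 2 ∧ u ∉ cleanTriples G) :
    S.card ≤ 6 * G.maxDegree := by
  obtain ⟨htc, htadj⟩ := mem_cleanTriples.1 ht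
  have hsub : S ⊆ t.offDiag.biUnion fun x =>
      (G.neighborFinset x.1).image fun r => insert r (t.erase x.2) := by
    intro u hu
    obtain ⟨huc, htu, hun⟩ := hS u hu
    obtain ⟨j, hj, r, hr, rfl⟩ := exists_eq_insert_erase htc huc htu
    have hex : ∃ i ∈ t.erase j, G.Adj i r := by
      by_contra! hcon
      refine hun (mem_cleanTriples.2 ⟨huc, fun x hx y hy => ?_⟩)
      rw [Finset.mem_insert] at hx hy
      rcases hx with rfl | hx <;> rcases hy with rfl | hy
      · exact G.loopless.irrefl _
      · exact fun h => hcon y hy h.symm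
      · exact hcon x hx
      · exact htadj x (Finset.mem_of_mem_erase hx) y (Finset.mem_of_mem_erase hy)
    obtain ⟨i, hi, hir⟩ := hex
    refine Finset.mem_biUnion.2 ⟨(i, j), Finset.mem_offDiag.2
      ⟨Finset.mem_of_mem_erase hi, hj, (Finset.mem_erase.1 hi).1⟩, ?_⟩
    exact Finset.mem_image.2 ⟨r, by simpa using hir, rfl⟩
  refine (Finset.card_le_card hsub).trans ?_
  have hoff : t.offDiag.card = 6 := by rw [Finset.offDiag_card, htc]
  rw [← hoff]
  refine Finset.card_biUnion_le_card_mul _ _ _ fun x _ => Finset.card_image_le.trans ?_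
  rw [G.card_neighborFinset_eq_degree]
  exact G.degree_le_maxDegree _

end Exchange

/-! ### Stationarity -/

/-- Doubling a symmetric sum that is supported on a cross. -/
lemma sum_sum_eq_two_mul_sum {ι : Type*} [Fintype ι] [DecidableEq ι] {f : ι → ι → ℝ} {i₀ : ι}
    (hsymm : ∀ i j, f i j = f j i) (hzero : ∀ i j, i ≠ i₀ → j ≠ i₀ → f i j = 0)
    (hdiag : f i₀ i₀ = 0) : ∑ i, ∑ j, f i j = 2 * ∑ j, f j i₀ := by
  have h : ∀ i j, f i j = (if i = i₀ then f j i₀ else 0) + if j = i₀ then f i i₀ else 0 := by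
    intro i j
    by_cases hi : i = i₀ <;> by_cases hj : j = i₀
    · simp [hi, hj, hdiag]
    · simp [hi, hj, hsymm i₀ j]
    · simp [hi, hj]
    · simp [hi, hj, hzero i j hi hj]
  calc ∑ i, ∑ j, f i j = ∑ i, ∑ j, ((if i = i₀ then f j i₀ else 0) + if j = i₀ then f i i₀ else 0) :=
        Finset.sum_congr rfl fun i _ => Finset.sum_congr rfl fun j _ => h i j
    _ = 2 * ∑ j, f j i₀ := by
        simp only [Finset.sum_add_distrib]
        rw [Finset.sum_comm]
        simp [two_mul]

/-- A strictly differentiable function grows at the rate of its derivative, uniformly near the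
base point. -/
lemma HasStrictDerivAt.eventually_sub_le {α : Type*} {l : Filter α} {f : ℝ → ℝ} {f' x : ℝ}
    (hf : HasStrictDerivAt f f' x) {r s : α → ℝ} (hr : Tendsto r l (𝓝 x))
    (hs : Tendsto s l (𝓝 0)) {ε : ℝ} (hε : 0 < ε) :
    ∀ᶠ i in l, f (r i + s i) - f (r i) ≤ s i * f' + ε * |s i| := by
  have ht : Tendsto (fun i => (r i + s i, r i)) l (𝓝 (x, x)) := by
    refine Tendsto.prodMk_nhds ?_ hr
    simpa using hr.add hs
  filter_upwards [ht.eventually (hf.hasStrictFDerivAt.isLittleO.def hε)] with i hi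
  simp only [add_sub_cancel_left, Real.norm_eq_abs] at hi
  have := (abs_le.1 hi).2
  simp at this
  linarith

namespace ScaleData

variable {n : ℕ} {Eb : SimpleGraph (Fin n)} (D : ScaleData Eb)

/-- Only constraints at `t` change, and each occurs in both orders with equal value, which cancels
the factor 1/2. -/
lemma fullObjective_update_sub {ρ : ℝ → ℝ → ℝ} {σ : ℝ} (heven : ∀ r, ρ σ (-r) = ρ σ r)
    (z : D.retained → ℝ) (t : D.retained) (s : ℝ) [DecidableEq D.retained] :
    D.fullObjective ρ σ (Function.update z t (z t + s)) - D.fullObjective ρ σ z =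
      ∑ u : D.retained, open Classical in if SharesEdge t.1 u.1
        then ρ σ (z t - z u - D.offset u.1 t.1 + s) - ρ σ (z t - z u - D.offset u.1 t.1)
        else 0 := by
  classical
  have hcomm : ∀ t u : Tri n, SharesEdge t u ↔ SharesEdge u t := fun t u => by
    rw [SharesEdge, SharesEdge, Finset.inter_comm]
  have hself : ∀ t : Tri n, ¬ SharesEdge t t := fun t h => by
    rw [SharesEdge, Finset.inter_self, t.2] at h
    omega
  have hsymm : ∀ (y : D.retained → ℝ) (t u : D.retained),
      (if SharesEdge t.1 u.1 then ρ σ (y u - y t - D.offset t.1 u.1) else 0) =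
        if SharesEdge u.1 t.1 then ρ σ (y t - y u - D.offset u.1 t.1) else 0 := by
    intro y t u
    rw [if_congr (hcomm t.1 u.1) rfl rfl]
    split_ifs
    · rw [← heven, D.offset_swap u.1 t.1]
      congr 1
      ring
    · rfl
  rw [fullObjective, fullObjective, ← mul_sub, ← Finset.sum_sub_distrib,
    Finset.sum_congr rfl fun t _ => (Finset.sum_sub_distrib (s := Finset.univ) _ _).symm]
  rw [sum_sum_eq_two_mul_sum (i₀ := t), ← mul_assoc]
  · rw [show (1 / 2 * 2 : ℝ) = 1 by norm_num, one_mul]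
    refine Finset.sum_congr rfl fun u _ => ?_
    rw [if_congr (hcomm u.1 t.1) rfl rfl, if_congr (hcomm u.1 t.1) rfl rfl]
    split_ifs with htu
    · have hne : u ≠ t := by
        rintro rfl
        exact hself _ htu
      rw [Function.update_of_ne hne, Function.update_self, sub_right_comm, sub_right_comm (z t),
        sub_add_eq_add_sub, add_sub_right_comm]
    · exact sub_zero _
  · intro i j
    rw [hsymm _ i j, hsymm z i j]
  · intro i j hi hj
    rw [Function.update_of_ne hi, Function.update_of_ne hj, sub_self]
  · simp [hself]

/-- A clean triangle as a retained one. -/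
def ofClean (t : CleanTri Eb) : D.retained := ⟨t.1, D.clean_retained t.1 t.2⟩

open Classical in
lemma join_add_single (y : CleanTri Eb → ℝ) (zb : D.BadTri → ℝ) (t : CleanTri Eb) (s c : ℝ) :
    D.join (y + s • Pi.single t c) zb =
      Function.update (D.join y zb) (D.ofClean t) (D.join y zb (D.ofClean t) + s * c) := by
  funext u
  by_cases hu : u = D.ofClean t
  · subst hu
    simp [join, ofClean, t.2]
  · rw [Function.update_of_ne hu]
    by_cases hc : IsClean Eb u.1
    · have hne : (⟨u.1, hc⟩ : CleanTri Eb) ≠ t := by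
        rintro rfl
        exact hu rfl
      simp [join, hc, hne]
    · simp [join, hc]

/-- A uniform bound on the growth of the full objective bounds that of the profiled one. -/
lemma profiledObjective_le_add {ρ : ℝ → ℝ → ℝ} {σ : ℝ} (hnn : ∀ r, 0 ≤ ρ σ r)
    {y y' : CleanTri Eb → ℝ} {δ : ℝ}
    (h : ∀ zb, D.fullObjective ρ σ (D.join y' zb) ≤ D.fullObjective ρ σ (D.join y zb) + δ) :
    D.profiledObjective ρ σ y' ≤ D.profiledObjective ρ σ y + δ := by
  have hbdd : BddBelow (Set.range fun zb => D.fullObjective ρ σ (D.join y' zb)) := by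
    refine ⟨0, ?_⟩
    rintro _ ⟨zb, rfl⟩
    refine mul_nonneg (by norm_num) (Finset.sum_nonneg fun t _ => Finset.sum_nonneg fun u _ => ?_)
    split_ifs
    · exact hnn _
    · exact le_rfl
  rw [← sub_le_iff_le_add]
  exact le_ciInf fun zb => sub_le_iff_le_add.2 ((ciInf_le hbdd zb).trans (h zb))

open Classical in
/-- The error `z_0 - z⋆` as a function of finite sets of cameras, zero off the clean triangles. -/
def errorOn (z0 : CleanTri Eb → ℝ) (F : Finset (Fin n)) : ℝ :=
  if h : ∃ hc : F.card = 3, IsClean Eb ⟨F, hc⟩ then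
    z0 ⟨⟨F, h.1⟩, h.2⟩ - D.trueScale ⟨⟨F, h.1⟩, h.2⟩ else 0

lemma errorOn_coe (z0 : CleanTri Eb → ℝ) (t : CleanTri Eb) :
    D.errorOn z0 t.1.1 = z0 t - D.trueScale t :=
  dif_pos (⟨t.1.2, t.2⟩ : ∃ hc : t.1.1.card = 3, IsClean Eb ⟨t.1.1, hc⟩)

lemma isClean_iff_mem_cleanTriples (t : Tri n) : IsClean Eb t ↔ t.1 ∈ cleanTriples Eb := by
  rw [mem_cleanTriples, IsClean, and_iff_right t.2]

end ScaleData

namespace ScaleData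

variable {n : ℕ} {Eb : SimpleGraph (Fin n)} (D : ScaleData Eb)

open Classical in
lemma sum_clean_neighbors (ψ : ℝ → ℝ) (X : Finset (Fin n) → ℝ) (t : Tri n) :
    ∑ u ∈ Finset.univ.filter fun u : D.retained => SharesEdge t u.1 ∧ IsClean Eb u.1,
      ψ (X t.1 - X u.1.1) = netFlow Eb ψ X t.1 := by
  rw [netFlow_eq_sum Eb ψ X t.2]
  refine Finset.sum_nbij (fun u => u.1.1) ?_ ?_ ?_ fun _ _ => rfl
  · intro u hu
    obtain ⟨h₁, h₂⟩ := (Finset.mem_filter.1 hu).2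
    exact Finset.mem_filter.2 ⟨(isClean_iff_mem_cleanTriples _).1 h₂, h₁⟩
  · intro u _ v _ huv
    exact Subtype.ext (Subtype.ext huv)
  · intro F hF
    obtain ⟨h₁, h₂⟩ := Finset.mem_filter.1 (Finset.mem_coe.1 hF)
    have hc : IsClean Eb ⟨F, (mem_cleanTriples.1 h₁).1⟩ := (isClean_iff_mem_cleanTriples _).2 h₁
    exact ⟨⟨_, D.clean_retained _ hc⟩, by simpa using ⟨h₂, hc⟩, rfl⟩

open Classical in
lemma card_bad_neighbors_le [DecidableRel Eb.Adj] {t : Tri n} (ht : IsClean Eb t) :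
    (Finset.univ.filter fun u : D.retained => SharesEdge t u.1 ∧ ¬ IsClean Eb u.1).card ≤
      6 * Eb.maxDegree := by
  rw [← Finset.card_image_of_injective (f := fun u : D.retained => u.1.1) _
    (Subtype.val_injective.comp Subtype.val_injective)]
  refine card_unclean_neighbors_le Eb ((isClean_iff_mem_cleanTriples t).1 ht) fun F hF => ?_
  obtain ⟨u, hu, rfl⟩ := Finset.mem_image.1 hF
  obtain ⟨h₁, h₂⟩ := (Finset.mem_filter.1 hu).2
  exact ⟨u.1.2, h₁, fun h => h₂ ((isClean_iff_mem_cleanTriples _).2 h)⟩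

variable {ρ : ℝ → ℝ → ℝ} {a m K σ : ℝ}

open Classical in
/-- The growth of the profiled objective along a coordinate direction. -/
lemma clarkeDeriv_profiledObjective_le [DecidableRel Eb.Adj] (hρ : ProfileAdmissible ρ a m K)
    (hK : 0 < K) (hσ : 0 < σ) {z0 : CleanTri Eb → ℝ}
    (hz : ∀ t u : CleanTri Eb, |D.errorOn z0 t.1.1 - D.errorOn z0 u.1.1| ≤ a * σ)
    (t : CleanTri Eb) {c : ℝ} (hc : |c| = 1) {ε : ℝ} (hε : 0 < ε) :
    clarkeDeriv (D.profiledObjective ρ σ) z0 (Pi.single t c) ≤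
      ((c * netFlow Eb (score ρ σ) (D.errorOn z0) t.1.1 + 6 * Eb.maxDegree * (K * σ) +
        Fintype.card D.retained * ε : ℝ) : EReal) := by
  set ψ := score ρ σ with hψ
  set X := D.errorOn z0 with hX
  -- `T` bounds the growth rate constraint by constraint: strict differentiability with slack `ε`
  -- towards clean triangles, the Lipschitz constant towards bad ones.
  set T : ℝ := ∑ u : D.retained, if SharesEdge t.1 u.1 then
    (if IsClean Eb u.1 then c * ψ (X t.1.1 - X u.1.1) + ε else K * σ) else 0 with hT
  have hTle : T ≤ c * netFlow Eb ψ X t.1.1 + 6 * Eb.maxDegree * (K * σ) +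
      Fintype.card D.retained * ε := by
    have hKσ := mul_pos hK hσ
    have hbad : ((Finset.univ.filter fun u : D.retained =>
        SharesEdge t.1 u.1 ∧ ¬ IsClean Eb u.1).card : ℝ) ≤ 6 * Eb.maxDegree := by
      exact_mod_cast D.card_bad_neighbors_le t.2
    calc T ≤ ∑ u : D.retained, ((if SharesEdge t.1 u.1 ∧ IsClean Eb u.1 then
            c * ψ (X t.1.1 - X u.1.1) else 0) +
          (if SharesEdge t.1 u.1 ∧ ¬ IsClean Eb u.1 then K * σ else 0) + ε) := by
          refine Finset.sum_le_sum fun u _ => ?_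
          by_cases h₁ : SharesEdge t.1 u.1 <;> by_cases h₂ : IsClean Eb u.1 <;>
            simp [h₁, h₂, hε.le]
      _ = c * netFlow Eb ψ X t.1.1 + (Finset.univ.filter fun u : D.retained =>
            SharesEdge t.1 u.1 ∧ ¬ IsClean Eb u.1).card * (K * σ) +
          Fintype.card D.retained * ε := by
          rw [Finset.sum_add_distrib, Finset.sum_add_distrib, ← Finset.sum_filter,
            ← Finset.mul_sum, sum_clean_neighbors, ← Finset.sum_filter, Finset.sum_const,
            nsmul_eq_mul, Finset.sum_const, nsmul_eq_mul, Finset.card_univ]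
      _ ≤ _ := by
          have := mul_le_mul_of_nonneg_right hbad hKσ.le
          linarith
  refine limsup_le_of_le (by isBoundedDefault) ?_
  have hp₁ : Tendsto (fun p : (CleanTri Eb → ℝ) × ℝ => p.1) (𝓝 z0 ×ˢ 𝓝[>] (0 : ℝ)) (𝓝 z0) :=
    tendsto_fst
  have hp₂ : Tendsto (fun p : (CleanTri Eb → ℝ) × ℝ => p.2) (𝓝 z0 ×ˢ 𝓝[>] (0 : ℝ)) (𝓝[>] 0) :=
    tendsto_snd
  have hpos : ∀ᶠ p : (CleanTri Eb → ℝ) × ℝ in 𝓝 z0 ×ˢ 𝓝[>] (0 : ℝ), 0 < p.2 :=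
    hp₂.eventually self_mem_nhdsWithin
  have hgrow : ∀ᶠ p : (CleanTri Eb → ℝ) × ℝ in 𝓝 z0 ×ˢ 𝓝[>] (0 : ℝ),
      ∀ u : CleanTri Eb, SharesEdge t.1 u.1 →
        ρ σ (p.1 t - p.1 u - D.offset u.1 t.1 + p.2 * c) -
          ρ σ (p.1 t - p.1 u - D.offset u.1 t.1) ≤
        p.2 * c * ψ (X t.1.1 - X u.1.1) + ε * |p.2 * c| := by
    refine eventually_all.2 fun u => ?_
    by_cases htu : SharesEdge t.1 u.1
    · have hut : SharesEdge u.1 t.1 := by rwa [SharesEdge, Finset.inter_comm]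
      have hlim : Tendsto (fun p : (CleanTri Eb → ℝ) × ℝ => p.1 t - p.1 u - D.offset u.1 t.1)
          (𝓝 z0 ×ˢ 𝓝[>] (0 : ℝ)) (𝓝 (X t.1.1 - X u.1.1)) := by
        have hval : X t.1.1 - X u.1.1 = z0 t - z0 u - D.offset u.1 t.1 := by
          rw [hX, errorOn_coe, errorOn_coe, D.offset_clean u t hut]
          ring
        rw [hval]
        exact ((((continuous_apply t).tendsto z0).comp hp₁).sub
          (((continuous_apply u).tendsto z0).comp hp₁)).sub_const _
      have hs : Tendsto (fun p : (CleanTri Eb → ℝ) × ℝ => p.2 * c)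
          (𝓝 z0 ×ˢ 𝓝[>] (0 : ℝ)) (𝓝 0) := by
        simpa using (hp₂.mono_right nhdsWithin_le_nhds).mul_const c
      have hstrict := hρ.hasStrictDerivAt hσ (hρ.differentiable_window σ hσ _ (hz t u))
      exact (hstrict.eventually_sub_le hlim hs hε).mono fun p hp _ => hp
    · exact Eventually.of_forall fun p h => absurd h htu
  filter_upwards [hpos, hgrow] with p hp hg
  rw [EReal.coe_le_coe_iff]
  refine le_trans ?_ hTle
  rw [div_le_iff₀ hp, sub_le_iff_le_add']
  -- The infimum is removed here: the increment is bounded for each fixed `zb` by the same quantity.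
  refine D.profiledObjective_le_add (hρ.nonneg σ hσ) fun zb => ?_
  have habs : |p.2 * c| = p.2 := by rw [abs_mul, hc, mul_one, abs_of_pos hp]
  rw [join_add_single, ← sub_le_iff_le_add', D.fullObjective_update_sub (hρ.even σ hσ), hT,
    Finset.sum_mul]
  refine Finset.sum_le_sum fun u _ => ?_
  by_cases h₁ : SharesEdge t.1 u.1
  · have h₁' : SharesEdge (D.ofClean t).1 u.1 := h₁
    rw [if_pos h₁, if_pos h₁']
    by_cases h₂ : IsClean Eb u.1
    · rw [if_pos h₂]
      have := hg ⟨u.1, h₂⟩ h₁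
      rw [habs] at this
      have ht : D.join p.1 zb (D.ofClean t) = p.1 t := by simp [join, ofClean, t.2]
      have hu : D.join p.1 zb u = p.1 ⟨u.1, h₂⟩ := by simp [join, h₂]
      rw [ht, hu]
      refine this.trans (le_of_eq ?_)
      ring
    · rw [if_neg h₂]
      refine (le_abs_self _).trans ((hρ.abs_sub_le hσ _ _).trans ?_)
      rw [add_sub_cancel_left, habs]
  · have h₁' : ¬ SharesEdge (D.ofClean t).1 u.1 := h₁
    rw [if_neg h₁, if_neg h₁', zero_mul]

/-- At a stationary point of the profiled objective, the bad triangles balance the net flow. -/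
lemma abs_netFlow_le [DecidableRel Eb.Adj] (hρ : ProfileAdmissible ρ a m K)
    (hK : 0 < K) (hσ : 0 < σ) {z0 : CleanTri Eb → ℝ}
    (hz : ∀ t u : CleanTri Eb, |D.errorOn z0 t.1.1 - D.errorOn z0 u.1.1| ≤ a * σ)
    (hstat : (0 : (CleanTri Eb → ℝ) →L[ℝ] ℝ) ∈
      clarkeSubdifferential (D.profiledObjective ρ σ) z0) (t : CleanTri Eb) :
    |netFlow Eb (score ρ σ) (D.errorOn z0) t.1.1| ≤ 6 * Eb.maxDegree * (K * σ) := by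
  classical
  -- Testing stationarity along the two directions `±e_t` gives the two sides of the bound.
  have key : ∀ c : ℝ, |c| = 1 →
      0 ≤ c * netFlow Eb (score ρ σ) (D.errorOn z0) t.1.1 + 6 * Eb.maxDegree * (K * σ) := by
    intro c hc
    refine le_of_forall_pos_le_add fun ε hε => ?_
    have hN : (0 : ℝ) < Fintype.card D.retained := by
      exact_mod_cast Fintype.card_pos_iff.2 ⟨D.ofClean t⟩
    have h := (hstat (Pi.single t c)).trans
      (D.clarkeDeriv_profiledObjective_le hρ hK hσ hz t hc (div_pos hε hN))
    rw [EReal.coe_le_coe_iff, mul_div_cancel₀ _ hN.ne'] at h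
    simpa using h
  rw [abs_le]
  constructor
  · linarith [key 1 (by norm_num)]
  · linarith [key (-1) (by norm_num)]

end ScaleData

/-! ### Gauge error: one-scale estimate and convergence. -/

namespace ScaleData

variable {n : ℕ} {Eb : SimpleGraph (Fin n)} (D : ScaleData Eb)

lemma gaugeError_nonneg (z0 : CleanTri Eb → ℝ) : 0 ≤ D.gaugeError z0 :=
  Real.iInf_nonneg fun _ => Real.iSup_nonneg fun _ => abs_nonneg _

lemma abs_sub_le_two_mul_gaugeError (z0 : CleanTri Eb → ℝ) (t u : CleanTri Eb) :
    |(z0 t - D.trueScale t) - (z0 u - D.trueScale u)| ≤ 2 * D.gaugeError z0 := by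
  rw [← div_le_iff₀' two_pos]
  refine le_ciInf fun α => ?_
  have hle : ∀ v, |z0 v - D.trueScale v - α| ≤ ⨆ t, |z0 t - D.trueScale t - α| := fun v =>
    le_ciSup (f := fun t => |z0 t - D.trueScale t - α|) (Set.finite_range _).bddAbove v
  have h := abs_sub_le (z0 t - D.trueScale t) α (z0 u - D.trueScale u)
  rw [abs_sub_comm α] at h
  linarith [hle t, hle u]

lemma gaugeError_le {z0 : CleanTri Eb → ℝ} {R : ℝ} (hR : 0 ≤ R)
    (h : ∀ t u, (z0 t - D.trueScale t) - (z0 u - D.trueScale u) ≤ 2 * R) :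
    D.gaugeError z0 ≤ R := by
  have hbdd : BddBelow (Set.range fun α : ℝ => ⨆ t, |z0 t - D.trueScale t - α|) := by
    refine ⟨0, ?_⟩
    rintro _ ⟨α, rfl⟩
    exact Real.iSup_nonneg fun _ => abs_nonneg _
  rcases isEmpty_or_nonempty (CleanTri Eb) with he | he
  · exact (ciInf_le hbdd 0).trans (by rw [Real.iSup_of_isEmpty]; exact hR)
  · obtain ⟨t, ht⟩ := Finite.exists_max fun t => z0 t - D.trueScale t
    -- The shift lies `R` below the maximal error, so an oscillation of at most `2 R` fits in a band
    -- of radius `R`.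
    refine (ciInf_le hbdd (z0 t - D.trueScale t - R)).trans (ciSup_le fun u => ?_)
    rw [abs_le]
    constructor
    · linarith [h t u]
    · linarith [ht u]

variable {ρ : ℝ → ℝ → ℝ} {a m K σ : ℝ}

/-- The error at a clean-basin stationary point. -/
theorem IsCleanBasinStationary.gaugeError_le [DecidableRel Eb.Adj]
    (hρ : ProfileAdmissible ρ a m K) (ha : 0 < a) (hm : 0 < m) (hK : 0 < K) (hσ : 0 < σ)
    (hn : 1000 ≤ n) (hdeg : 200 * Eb.maxDegree ≤ n)
    (hgain : 96 * (Eb.maxDegree : ℝ) / n < hProf a m K) {z : D.retained → ℝ}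
    (hz : D.IsCleanBasinStationary ρ a σ z) :
    D.gaugeError (D.cleanBlock z) ≤ 96 * (Eb.maxDegree : ℝ) / n * K / m * σ := by
  set Δ : ℝ := (Eb.maxDegree : ℝ) with hΔ
  have hΔ0 : 0 ≤ Δ := Nat.cast_nonneg _
  have hn0 : (0 : ℝ) < n := by exact_mod_cast (by omega : 0 < n)
  set X := D.errorOn (D.cleanBlock z) with hX
  have hwin : ∀ t u : CleanTri Eb, |X t.1.1 - X u.1.1| ≤ a * σ := by
    intro t u
    rw [hX, errorOn_coe, errorOn_coe]
    linarith [D.abs_sub_le_two_mul_gaugeError (D.cleanBlock z) t u, hz.2]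
  have hclean : ∀ F ∈ cleanTriples Eb, ∃ t : CleanTri Eb, t.1.1 = F := fun F hF =>
    ⟨⟨⟨F, (mem_cleanTriples.1 hF).1⟩, (isClean_iff_mem_cleanTriples _).2 hF⟩, rfl⟩
  set β : ℝ := 6 * Δ * (K * σ) / n with hβ
  have hβ0 : 0 ≤ β := by positivity
  -- This is exactly the small-gain condition `96 Δ / n < a m / (2 K)`, scaled by `2 K σ`.
  have hβq : 32 * β < m * (a * σ) := by
    rw [hProf, div_lt_div_iff₀ hn0 (by positivity)] at hgain
    rw [hβ, ← mul_div_assoc, div_lt_iff₀ hn0]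
    have := mul_lt_mul_of_pos_right hgain hσ
    linarith
  have hosc : ∀ t u : CleanTri Eb, m * (X t.1.1 - X u.1.1) ≤ 32 * β := by
    intro t u
    by_contra! hcon
    -- The oscillation theorem needs a positive level, while `β = 0` when no edge is corrupted. A
    -- level slightly above `β`, still under the truncation and under the supposed violation, gives
    -- the contradiction.
    have hlt : β < min (m * (a * σ) / 32) ((β + m * (X t.1.1 - X u.1.1) / 32) / 2) :=
      lt_min (by linarith) (by linarith)
    have hmin := min_le_left (m * (a * σ) / 32) ((β + m * (X t.1.1 - X u.1.1) / 32) / 2)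
    have hmin' := min_le_right (m * (a * σ) / 32) ((β + m * (X t.1.1 - X u.1.1) / 32) / 2)
    set β' := min (m * (a * σ) / 32) ((β + m * (X t.1.1 - X u.1.1) / 32) / 2)
    have := mul_sub_le_of_abs_netFlow_le Eb (hρ.monotoneMinorant ha hm hσ) hm (hρ.odd σ hσ)
      (X := X) (β := β') (t := t.1.1) (u := u.1.1)
      (fun F hF F' hF' => by
        obtain ⟨v, rfl⟩ := hclean F hF
        obtain ⟨v', rfl⟩ := hclean F' hF'
        exact (le_abs_self _).trans (hwin v v'))
      (fun F hF => by
        obtain ⟨v, rfl⟩ := hclean F hF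
        refine (D.abs_netFlow_le hρ hK hσ hwin hz.1 v).trans ?_
        rw [Fintype.card_fin, ← div_le_iff₀' hn0]
        exact hlt.le)
      (hβ0.trans_lt hlt) (by linarith) (by rwa [Fintype.card_fin]) (by rwa [Fintype.card_fin])
      ((isClean_iff_mem_cleanTriples _).1 t.2) ((isClean_iff_mem_cleanTriples _).1 u.2)
    linarith
  refine D.gaugeError_le (by positivity) fun t u => ?_
  have h := hosc t u
  rw [hX, errorOn_coe, errorOn_coe, ← le_div_iff₀' hm] at h
  refine h.trans (le_of_eq ?_)
  rw [hβ]
  field_simp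
  ring

/-- Vanishing gauge error means convergence of the gauge-normalized iterates. -/
theorem tendsto_of_gaugeError {z : ℕ → CleanTri Eb → ℝ}
    (hz : Tendsto (fun k => D.gaugeError (z k)) atTop (𝓝 0))
    (gauge : (CleanTri Eb → ℝ) →ₗ[ℝ] ℝ) (hgauge : gauge (fun _ => 1) = 1) (β : ℝ)
    (t : CleanTri Eb) :
    Tendsto (fun k => z k t - gauge (z k) + β) atTop
      (𝓝 (D.trueScale t + (β - gauge D.trueScale))) := by
  -- Recentring the error at `t` removes the unknown shift: every coordinate of `v k` is at most
  -- twice the gauge error, and `gauge (v k)` is, up to sign and a constant, the normalized iterate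
  -- at `t`.
  set v : ℕ → CleanTri Eb → ℝ := fun k =>
    z k - D.trueScale - (z k t - D.trueScale t) • (fun _ => (1 : ℝ)) with hv
  have hv0 : Tendsto v atTop (𝓝 0) := by
    rw [tendsto_pi_nhds]
    intro u
    refine squeeze_zero_norm (a := fun k => 2 * D.gaugeError (z k)) (fun k => ?_) ?_
    · have := D.abs_sub_le_two_mul_gaugeError (z k) u t
      simpa [hv] using this
    · simpa using hz.const_mul 2
  have hlim := ((LinearMap.continuous_of_finiteDimensional gauge).tendsto 0).comp hv0
  rw [map_zero] at hlim
  have h := hlim.const_sub (D.trueScale t + (β - gauge D.trueScale))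
  rw [sub_zero] at h
  refine h.congr fun k => ?_
  simp only [hv, Function.comp, map_sub, map_smul, hgauge, smul_eq_mul, mul_one]
  ring

end ScaleData

end

/-! ### Annealing. -/

theorem mainTheorem5 (a m K : ℝ) (ha : 0 < a) (hm : 0 < m) (hK : 0 < K) :
    ∃ n₀ : ℕ, ∀ n : ℕ, n₀ ≤ n →
      ∀ (Eb : SimpleGraph (Fin n)) [DecidableRel Eb.Adj],
        (Eb.maxDegree : ℝ) / n < min (1 / 200) (hProf a m K / (96 + 2 * hProf a m K)) →
        ∃ γ : ℝ, 0 ≤ γ ∧ γ < hProf a m K ∧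
          γ ≤ 16 * (6 * (Eb.maxDegree : ℝ)) / (n - 3 - 2 * (Eb.maxDegree : ℝ)) ∧
          ∀ ρ : ℝ → ℝ → ℝ, ProfileAdmissible ρ a m K →
            ∀ (D : ScaleData Eb) (σ₀ τ : ℝ), 0 < σ₀ →
              2 * γ * K / (a * m) < τ → τ < 1 →
              ∀ z : ℕ → D.retained → ℝ, D.IsAnnealedRun ρ a σ₀ τ z →
                (∀ k : ℕ,
                  D.gaugeError (D.cleanBlock (z k)) ≤ γ * K / m * (σ₀ * τ ^ k) ∧
                  γ * K / m * (σ₀ * τ ^ k) ≤ a / 2 * (σ₀ * τ ^ (k + 1)) ∧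
                  D.gaugeError (D.cleanBlock (z k)) ≤ a / 2 * σ₀ * τ ^ k) ∧
                (∀ (gauge : (CleanTri Eb → ℝ) →ₗ[ℝ] ℝ), gauge (fun _ => 1) = 1 →
                  ∀ (β : ℝ) (t : CleanTri Eb),
                    Filter.Tendsto
                      (fun k => D.cleanBlock (z k) t - gauge (D.cleanBlock (z k)) + β)
                      Filter.atTop (nhds (D.trueScale t + (β - gauge D.trueScale)))) := by
  refine ⟨1000, fun n hn Eb _ hdeg => ?_⟩
  obtain ⟨hdeg₁, hdeg₂⟩ := lt_min_iff.1 hdeg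
  have hn' : (1000 : ℝ) ≤ n := by exact_mod_cast hn
  have hn0 : (0 : ℝ) < n := by linarith
  have hΔ0 : (0 : ℝ) ≤ Eb.maxDegree := Nat.cast_nonneg _
  have hh : 0 < hProf a m K := div_pos (mul_pos ha hm) (by linarith)
  rw [div_lt_div_iff₀ hn0 (by norm_num), one_mul] at hdeg₁
  have hdegN : 200 * Eb.maxDegree ≤ n := by
    have : (200 * Eb.maxDegree : ℝ) ≤ n := by linarith
    exact_mod_cast this
  have hgain : 96 * (Eb.maxDegree : ℝ) / n < hProf a m K := by
    rw [lt_div_iff₀ (by linarith)] at hdeg₂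
    have : 0 ≤ (Eb.maxDegree : ℝ) / n * (2 * hProf a m K) := by positivity
    rw [mul_div_assoc]
    linarith
  -- Here 96 = 16 · 6, with the larger denominator `n` in place of `n - 3 - 2 Δ`.
  refine ⟨96 * (Eb.maxDegree : ℝ) / n, by positivity, hgain, ?_, ?_⟩
  · rw [← mul_assoc]
    norm_num
    exact div_le_div_of_nonneg_left (by positivity) (by linarith) (by linarith)
  intro ρ hρ D σ₀ τ hσ₀ hτ _ z hz
  set γ : ℝ := 96 * (Eb.maxDegree : ℝ) / n with hγ
  have hγ0 : 0 ≤ γ := by positivity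
  have hτ0 : 0 < τ := lt_of_le_of_lt (by positivity) hτ
  have hstep : ∀ k : ℕ, γ * K / m * (σ₀ * τ ^ k) ≤ a / 2 * (σ₀ * τ ^ (k + 1)) := by
    intro k
    have hσ : 0 < σ₀ * τ ^ k := by positivity
    have : γ * K / m ≤ a / 2 * τ := by
      rw [div_lt_iff₀ (by positivity)] at hτ
      rw [div_le_iff₀ hm]
      linarith
    calc γ * K / m * (σ₀ * τ ^ k) ≤ a / 2 * τ * (σ₀ * τ ^ k) :=
          mul_le_mul_of_nonneg_right this hσ.le
      _ = a / 2 * (σ₀ * τ ^ (k + 1)) := by ring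
  have herr : ∀ k : ℕ, D.IsCleanBasinStationary ρ a (σ₀ * τ ^ k) (z k) →
      D.gaugeError (D.cleanBlock (z k)) ≤ γ * K / m * (σ₀ * τ ^ k) := fun k hk =>
    hk.gaugeError_le D hρ ha hm hK (by positivity) hn hdegN hgain
  have hstat : ∀ k : ℕ, D.IsCleanBasinStationary ρ a (σ₀ * τ ^ k) (z k) := by
    intro k
    induction k with
    | zero => simpa using hz.1
    -- The error at scale `σ_k` already fits the basin of `σ_{k+1}`, so the run's conditional
    -- guarantee applies.
    | succ k ih => exact hz.2 k ((herr k ih).trans (hstep k))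
  refine ⟨fun k => ⟨herr k (hstat k), hstep k, ?_⟩, fun gauge hgauge β t => ?_⟩
  · rw [mul_assoc]
    exact (hstat k).2
  · refine D.tendsto_of_gaugeError (squeeze_zero (fun k => D.gaugeError_nonneg _)
      (fun k => herr k (hstat k)) ?_) gauge hgauge β t
    have := ((tendsto_pow_atTop_nhds_zero_of_lt_one hτ0.le ‹τ < 1›).const_mul σ₀).const_mul
      (γ * K / m)
    simpa using this
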